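/- Let $\kappa>0$. For $\vec r,\vec v\in\mathbb R^3$ with $\vec r\neq 0$ put $E=\tfrac12|\vec v|^2-\kappa|\vec r|^{-1}$, $\vec L=\vec r\times\vec v$, $\vec A=\vec v\times\vec L-\kappa|\vec r|^{-1}\vec r$, $\vec\Theta=|\vec A|^{-1}\vec A$, and, if $E\ne0$, $\vec M=\vec A/\sqrt{2|E|}$. Let $D_t=\partial_t+\vec v\cdot\partial_{\vec r}-\kappa|\vec r|^{-3}\vec r\cdot\partial_{\vec v}$. For $\vec\varepsilon\in\mathbb R^3$, the symmetry generator of the constant of motion $\vec\varepsilon\cdot\vec A$ is $\hat{\bf X}_{\vec\varepsilon}=\vec P\cdot\partial_{\vec r}+D_t\vec P\cdot\partial_{\vec v}$ with $\vec P=\partial(\vec\varepsilon\cdot\vec A)/\partial\vec v=2(\vec\varepsilon\cdot\vec r)\vec v-(\vec\varepsilon\cdot\vec v)\vec r-(\vec r\cdot\vec v)\vec\varepsilon$ and $D_t\vec P=(\vec\varepsilon\cdot\vec v)\vec v-\kappa|\vec r|^{-3}(\vec\varepsilon\cdot\vec r)\vec r-(|\vec v|^2-\kappa|\vec r|^{-1})\vec\varepsilon$.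 On the region $\vec r\cdot\vec v\neq0$ of $(t,\vec r,\vec v)$-space consider the vector field $\vec\varepsilon\cdot{\bf Y}=(\vec\varepsilon\cdot\vec\tau)D_t+\hat{\bf X}_{\vec\varepsilon}$ with $\vec\tau=(\vec L\times\vec r)/(\vec r\cdot\vec v)$, the only gauge for which $|\vec r|$ is invariant for all $\vec\varepsilon$. Write $(t,\vec r,\vec v)^*=\exp(\vec\varepsilon\cdot{\bf Y})(t,\vec r,\vec v)$ for the endpoint at parameter time $1$ of the integral curve of this field (inside the region $\vec r\cdot\vec v\ne0$) that starts at $(t,\vec r,\vec v)$. For $\phi\in\mathbb R$ and a vector $\hat n$ define the twisted rotation of a pair of vectors by $$\underline R_E(\phi,\hat n)\begin{pmatrix}\vec L\\ \vec M\end{pmatrix}=c\begin{pmatrix}\vec L\\ \vec M\end{pmatrix}+(1-c)\begin{pmatrix}(\hat n\cdot\vec L)\,\hat n\\(\hat n\cdot\vec M)\,\hat n\end{pmatrix}+s\begin{pmatrix}\hat n\times\vec M\\-\mathrm{sgn}(E)\,\hat n\times\vec L\end{pmatrix},$$ where $(c,s)=(\cos\phi,\sin\phi)$ if $E<0$ (internal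 $SO(2)$) and $(c,s)=(\cosh\phi,\sinh\phi)$ if $E>0$ (internal $SO(1,1)$). **Theorem.** Let $(t,\vec r,\vec v)$ satisfy $\vec r\cdot\vec v\neq0$, let $E,\vec L,\vec A,\vec\Theta,\vec M$ be the values at $(\vec r,\vec v)$, and let $\vec\varepsilon\in\mathbb R^3$. Define $\vec L^*,\vec\Theta^*$ as functions of $\vec\varepsilon$ as follows. If $E\ne0$, $$\begin{pmatrix}\vec L^*\\ \vec M^*\end{pmatrix}=\underline R_E\big(\sqrt{2|E|}\,|\vec\varepsilon|,\hat\varepsilon\big)\begin{pmatrix}\vec L\\ \vec M\end{pmatrix},\qquad \hat\varepsilon=|\vec\varepsilon|^{-1}\vec\varepsilon,\qquad\vec\Theta^*=|\vec M^*|^{-1}\vec M^*$$ (the identity if $\vec\varepsilon=0$); if $E=0$, $\vec\Theta^*=\vec\Theta$ and $\vec L^*=\vec L+|\vec A|\,\vec\varepsilon\times\vec\Theta$. Put $|\vec A^*|=\sqrt{\kappa^2+2E|\vec L^*|^2}$, $\rho^*=2(E+\kappa|\vec r|^{-1})-(|\vec r|^{-1}|\vec L^*|)^2$, and $$\alpha^r{}^*=\frac{|\vec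 L^*|^2-\kappa|\vec r|}{|\vec A^*|},\quad \beta^r{}^*=\frac{\mathrm{sgn}(\vec r\cdot\vec v)\,|\vec r|\sqrt{\rho^*}}{|\vec A^*|},\quad \alpha^v{}^*=-\frac{\mathrm{sgn}(\vec r\cdot\vec v)\,\kappa\sqrt{\rho^*}}{|\vec A^*|},\quad \beta^v{}^*=\frac{2E+\kappa|\vec r|^{-1}}{|\vec A^*|}.$$ (a) The transformation $\exp(\vec\varepsilon\cdot{\bf Y})$ is defined at $(t,\vec r,\vec v)$ if and only if $\rho^*(s\vec\varepsilon)>0$ for all $s\in[0,1]$. (b) When it is defined, it has the explicit form $$\vec r^{\,*}=\alpha^r{}^*\vec\Theta^*+\beta^r{}^*\,\vec L^*\times\vec\Theta^*,\qquad \vec v^{\,*}=\alpha^v{}^*\vec\Theta^*+\beta^v{}^*\,\vec L^*\times\vec\Theta^*,$$ $$t^*=t+\int_0^{\vec\varepsilon}\frac{\alpha^r{}^*\,\vec L^*\times\vec\Theta^*-\beta^r{}^*|\vec L^*|^2\,\vec\Theta^*}{\mathrm{sgn}(\vec r\cdot\vec v)\,|\vec r|\sqrt{\rho^*}}\cdot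 d\vec\varepsilon,$$ the (convergent) integral being taken along the segment $s\mapsto s\vec\varepsilon$, $0\le s\le1$. The angular momentum, the LRL direction and the magnitude of the LRL vector at $(\vec r^{\,*},\vec v^{\,*})$ are $\vec L^*$, $\vec\Theta^*$ and $|\vec A^*|$, and $E$ and $|\vec r|$ are invariant. (c) When it is defined and $E\neq0$, one has $\vec M=|\vec M|\vec\Theta$ with $|\vec M|^2=\mathrm{sgn}(E)|\vec L|^2+\tfrac12\kappa^2|E|^{-1}$, the values of $(\vec L,\vec M)$ at $(\vec r^{\,*},\vec v^{\,*})$ are given by the twisted rotation $\underline R_E(\sqrt{2|E|}\,|\vec\varepsilon|,\hat\varepsilon)$ applied to their values at $(\vec r,\vec v)$, and $|\vec M|^2-\mathrm{sgn}(E)|\vec L|^2$ is invariant. (d) When it is defined and $E=0$, $\vec\Theta$ is invariant, $\vec L$ is carried to $\vec L+|\vec A|\,\vec\varepsilon\times\vec\Theta$, $|\vec A|^2=\kappa^2+2E|\vec L|^2$, and $|\vec A^*|=|\vec A|\sqrt{1+2E|\vec A|^{-1}\big(\vec\varepsilon\cdot(\vec\Theta\times\vec L)+|\vec\varepsilon|^2-(\vec\varepsilon\cdot\vec\Theta)^2\big)}$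 (which is $|\vec A|$, as $E=0$). -/

import Mathlib

open Set MeasureTheory
open scoped RealInnerProductSpace

namespace Kepler

noncomputable section

/-- Three-dimensional Euclidean space. -/
abbrev E3 := EuclideanSpace ℝ (Fin 3)

/-- The cross product on Euclidean three-space. -/
def cross (a b : E3) : E3 := WithLp.toLp 2 (crossProduct a.ofLp b.ofLp)

/-- The coordinate space of triples `(t, r, v)`. -/
abbrev State := ℝ × E3 × E3

/-! ### Constants of motion -/

/-- Energy `E = |v|² / 2 - κ / |r|`. -/
def energy (κ : ℝ) (r v : E3) : ℝ := ‖v‖ ^ 2 / 2 - κ / ‖r‖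

/-- Angular momentum `L = r × v`. -/
def angMom (r v : E3) : E3 := cross r v

/-- The Laplace-Runge-Lenz vector `A = v × L - κ r / |r|`. -/
def lrl (κ : ℝ) (r v : E3) : E3 := cross v (angMom r v) - (κ / ‖r‖) • r

/-- The direction `Θ = A / |A|` of the Laplace-Runge-Lenz vector. -/
def lrlDir (κ : ℝ) (r v : E3) : E3 := ‖lrl κ r v‖⁻¹ • lrl κ r v

/-- The rescaled vector `M = A / √(2|E|)`, used for `E ≠ 0`. -/
def lrlM (κ : ℝ) (r v : E3) : E3 := (√(2 * |energy κ r v|))⁻¹ • lrl κ r v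

/-! ### The symmetry generator -/

/-- Position component `P` of the symmetry generator of the constant of motion `e · A`,
that is, `P = ∂(e · A)/∂v`. -/
def lrlP (e r v : E3) : E3 := (2 * ⟪e, r⟫) • v - ⟪e, v⟫ • r - ⟪r, v⟫ • e

/-- Velocity component of the generator of `e · A`: the time derivative of `lrlP e r v` on
solutions of `r'' = -κ |r|⁻³ r`. -/
def lrlDtP (κ : ℝ) (e r v : E3) : E3 :=
  ⟪e, v⟫ • v - (κ / ‖r‖ ^ 3 * ⟪e, r⟫) • r - (‖v‖ ^ 2 - κ / ‖r‖) • e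

/-- The total derivative `D_t = ∂_t + v · ∂_r - κ |r|⁻³ r · ∂_v`. -/
def totalD (κ : ℝ) (x : State) : State := (1, x.2.2, -(κ / ‖x.2.1‖ ^ 3) • x.2.1)

/-- The generator `e · Y = ∑ⱼ eʲ (τʲ D_t + X̂_{Aʲ})` on `(t, r, v)`-space, with gauge function
`τ`. -/
def lrlY (κ : ℝ) (τ : State → E3) (e : E3) (x : State) : State :=
  ⟪τ x, e⟫ • totalD κ x + (0, lrlP e x.2.1 x.2.2, lrlDtP κ e x.2.1 x.2.2)

/-- The region where the gauge can be fixed by the invariance of `|r|`. -/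
def gaugeDomain : Set State := {x | ⟪x.2.1, x.2.2⟫ ≠ 0}

/-- The gauge function `τ = (L × r) / (r · v)`, the only one on `gaugeDomain` for which `|r|` is
invariant (see `gauge_unique`). -/
def gauge (x : State) : E3 := ⟪x.2.1, x.2.2⟫⁻¹ • cross (angMom x.2.1 x.2.2) x.2.1

/-- `y = exp(ε · Y) x`: an integral curve of the gauge-fixed vector field `ε · Y` leads from `x`
to `y` in unit parameter time, within the region where the field is defined. -/
def IsLRLTransform (κ : ℝ) (ε : E3) (x y : State) : Prop :=
  ∃ γ : ℝ → State, γ 0 = x ∧ γ 1 = y ∧ ∀ s ∈ Icc (0 : ℝ) 1,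
    γ s ∈ gaugeDomain ∧ HasDerivWithinAt γ (lrlY κ gauge ε (γ s)) (Icc 0 1) s

/-! ### The explicit form of the transformation -/

/-- `cos` for `E < 0`, `cosh` for `E > 0`. -/
def cosE (E φ : ℝ) : ℝ := if E < 0 then Real.cos φ else Real.cosh φ

/-- `sin` for `E < 0`, `sinh` for `E > 0`. -/
def sinE (E φ : ℝ) : ℝ := if E < 0 then Real.sin φ else Real.sinh φ

/-- The twisted rotation `cosE φ I + (1 - cosE φ) I n n· + sinE φ S n×` of pairs `(L, M)`, where
`S` is the internal matrix with rows `(0, 1)` and `(-sgn E, 0)`. -/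
def twistedRotation (E φ : ℝ) (n : E3) (p : E3 × E3) : E3 × E3 :=
  (cosE E φ • p.1 + ((1 - cosE E φ) * ⟪n, p.1⟫) • n + sinE E φ • cross n p.2,
   cosE E φ • p.2 + ((1 - cosE E φ) * ⟪n, p.2⟫) • n
     - (Real.sign E * sinE E φ) • cross n p.1)

/-- The twisted rotation with parameters `φ = √(2|E|) |ε|` and `n = ε / |ε|`, applied to the
values of `(L, M)` at `(r, v)`. -/
def rotatedLM (κ : ℝ) (r v ε : E3) : E3 × E3 :=
  twistedRotation (energy κ r v) (√(2 * |energy κ r v|) * ‖ε‖) (‖ε‖⁻¹ • ε)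
    (angMom r v, lrlM κ r v)

/-- The explicit transformed angular momentum `L*`. -/
def starL (κ : ℝ) (r v ε : E3) : E3 :=
  if energy κ r v = 0 then angMom r v + ‖lrl κ r v‖ • cross ε (lrlDir κ r v)
  else (rotatedLM κ r v ε).1

/-- The explicit transformed direction vector `Θ*`. -/
def starTheta (κ : ℝ) (r v ε : E3) : E3 :=
  if energy κ r v = 0 then lrlDir κ r v
  else ‖(rotatedLM κ r v ε).2‖⁻¹ • (rotatedLM κ r v ε).2

/-- The magnitude `|A*| = √(κ² + 2E|L*|²)`. -/
def starA (κ : ℝ) (r v ε : E3) : ℝ := √(κ ^ 2 + 2 * energy κ r v * ‖starL κ r v ε‖ ^ 2)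

/-- The squared radial velocity `2(E + κ/|r|) - (|L*|/|r|)²`. -/
def starRadicand (κ : ℝ) (r v ε : E3) : ℝ :=
  2 * (energy κ r v + κ / ‖r‖) - (‖starL κ r v ε‖ / ‖r‖) ^ 2

/-- The scalar product `r* · v* = sgn(r · v) |r| √(2(E + κ/|r|) - (|L*|/|r|)²)`. -/
def starRV (κ : ℝ) (r v ε : E3) : ℝ :=
  Real.sign ⟪r, v⟫ * ‖r‖ * √(starRadicand κ r v ε)

def alphaR (κ : ℝ) (r v ε : E3) : ℝ := (‖starL κ r v ε‖ ^ 2 - κ * ‖r‖) / starA κ r v ε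

def betaR (κ : ℝ) (r v ε : E3) : ℝ :=
  Real.sign ⟪r, v⟫ * ‖r‖ * √(starRadicand κ r v ε) / starA κ r v ε

def alphaV (κ : ℝ) (r v ε : E3) : ℝ :=
  -(Real.sign ⟪r, v⟫ * κ * √(starRadicand κ r v ε)) / starA κ r v ε

def betaV (κ : ℝ) (r v ε : E3) : ℝ := (2 * energy κ r v + κ / ‖r‖) / starA κ r v ε

/-- The integrand of the quadrature for `t*`. -/
def starTau (κ : ℝ) (r v ε : E3) : E3 :=
  (starRV κ r v ε)⁻¹ •
    (alphaR κ r v ε • cross (starL κ r v ε) (starTheta κ r v ε)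
      - (betaR κ r v ε * ‖starL κ r v ε‖ ^ 2) • starTheta κ r v ε)

/-! ### The generator and the gauge are the intended ones -/

lemma inner_eq (a b : E3) : ⟪a, b⟫ = a 0 * b 0 + a 1 * b 1 + a 2 * b 2 := by
  simp [PiLp.inner_apply, Fin.sum_univ_three, mul_comm]

lemma norm_sq_coords (a : E3) : ‖a‖ ^ 2 = a 0 ^ 2 + a 1 ^ 2 + a 2 ^ 2 := by
  rw [← real_inner_self_eq_norm_sq, inner_eq]; ring

lemma lrl_eq (κ : ℝ) (r v : E3) :
    lrl κ r v = ⟪v, v⟫ • r - ⟪r, v⟫ • v - (κ / ‖r‖) • r := by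
  ext i
  fin_cases i <;>
    simp [lrl, angMom, cross, inner_eq, norm_sq_coords, cross_apply] <;> ring

/-- `lrlP` is the velocity gradient of the component `e · A`. -/
lemma hasGradientAt_lrl (κ : ℝ) (e r v : E3) :
    HasGradientAt (fun w => ⟪e, lrl κ r w⟫) (lrlP e r v) v := by
  have h : (fun w => ⟪e, lrl κ r w⟫)
      = fun w => ⟪w, w⟫ * ⟪e, r⟫ - ⟪r, w⟫ * ⟪e, w⟫ - κ / ‖r‖ * ⟪e, r⟫ := by
    funext w
    rw [lrl_eq]
    simp only [inner_sub_right, inner_smul_right]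
  rw [h, hasGradientAt_iff_hasFDerivAt]
  have hid := hasFDerivAt_id (𝕜 := ℝ) v
  have h1 := hid.inner ℝ hid
  have h2 := (hasFDerivAt_const r v).inner ℝ hid
  have h3 := (hasFDerivAt_const e v).inner ℝ hid
  refine (((h1.mul_const ⟪e, r⟫).sub (h2.mul h3)).sub_const (κ / ‖r‖ * ⟪e, r⟫)).congr_fderiv ?_
  ext w
  simp [lrlP, inner_eq]
  ring

/-- `lrlDtP` is the derivative of `lrlP` along solutions of the equation of motion. -/
lemma hasDerivAt_lrlP (κ : ℝ) (e : E3) (r v : ℝ → E3) (t : ℝ) (h0 : r t ≠ 0)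
    (hr : HasDerivAt r (v t) t) (hv : HasDerivAt v (-(κ / ‖r t‖ ^ 3) • r t) t) :
    HasDerivAt (fun s => lrlP e (r s) (v s)) (lrlDtP κ e (r t) (v t)) t := by
  have hn : ‖r t‖ ≠ 0 := norm_ne_zero_iff.mpr h0
  have he := hasDerivAt_const t e
  have h1 := (((he.inner ℝ hr).const_mul 2).smul hv)
  have h2 := (he.inner ℝ hv).smul hr
  have h3 := (hr.inner ℝ hv).smul he
  refine ((h1.sub h2).sub h3).congr_deriv ?_
  have hsq : κ / ‖r t‖ = κ / ‖r t‖ ^ 3 * ⟪r t, r t⟫ := by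
    rw [real_inner_self_eq_norm_sq]; field_simp
  simp only [lrlDtP]
  rw [hsq, ← real_inner_self_eq_norm_sq (v t)]
  generalize κ / ‖r t‖ ^ 3 = q
  ext i
  fin_cases i <;> simp [inner_eq, norm_sq_coords] <;> ring

/-- A gauge function makes `|r|` invariant at a point with `r · v ≠ 0`, in all directions `e`,
exactly if it has the value `gauge` there. -/
lemma gauge_unique (κ : ℝ) (τ : State → E3) (x : State) (hx : x ∈ gaugeDomain) :
    (∀ e : E3, fderiv ℝ (fun y : State => ‖y.2.1‖) x (lrlY κ τ e x) = 0) ↔ τ x = gauge x := by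
  obtain ⟨t, r, v⟩ := x
  have hrv : ⟪r, v⟫ ≠ 0 := hx
  have hr : r ≠ 0 := by rintro rfl; simp at hrv
  have hn : ‖r‖ ≠ 0 := norm_ne_zero_iff.mpr hr
  have hd : ∀ w : State, fderiv ℝ (fun y : State => ‖y.2.1‖) (t, r, v) w
      = ‖r‖⁻¹ * ⟪r, w.2.1⟫ := by
    intro w
    have hf : HasFDerivAt (fun y : State => y.2.1)
        ((ContinuousLinearMap.fst ℝ E3 E3).comp (ContinuousLinearMap.snd ℝ ℝ (E3 × E3)))
        (t, r, v) :=
      ((ContinuousLinearMap.fst ℝ E3 E3).comp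
        (ContinuousLinearMap.snd ℝ ℝ (E3 × E3))).hasFDerivAt
    have hs := (hf.norm_sq).sqrt (by simpa using hr)
    have : (fun y : State => ‖y.2.1‖) = fun y : State => √(‖y.2.1‖ ^ 2) := by
      funext y; rw [Real.sqrt_sq (norm_nonneg _)]
    rw [this, hs.fderiv]
    simp
    field_simp
  have key : ∀ e : E3, ⟪r, (lrlY κ τ e (t, r, v)).2.1⟫
      = ⟪⟪r, v⟫ • τ (t, r, v) - cross (angMom r v) r, e⟫ := by
    intro e
    simp [lrlY, totalD, lrlP, inner_eq, cross, angMom, cross_apply]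
    ring
  simp only [hd, key, mul_eq_zero, inv_eq_zero, hn, false_or]
  constructor
  · intro h
    have h0 := inner_self_eq_zero.mp (h (⟪r, v⟫ • τ (t, r, v) - cross (angMom r v) r))
    rw [sub_eq_zero] at h0
    rw [gauge, ← h0, smul_smul, inv_mul_cancel₀ hrv, one_smul]
  · intro h e
    rw [h, gauge, smul_smul, mul_inv_cancel₀ hrv, one_smul, sub_self, inner_zero_left]

end

end Kepler

/-!
The generator `ε · Y` acts linearly on the orbital elements. The multiple of `D_t` that fixes the
gauge does not change the constants of motion `L` and `A`, and on them the symmetry generator acts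
by `L' = ε × A`, `A' = -2E ε × L` (`cross_generator`, `lrl_generator`), while the gauge makes `|r|`,
and with the energy also `|v|`, invariant. As `E` is constant, this is a linear system with
constant coefficients; its solution is the twisted rotation of `(L, M)` for `E ≠ 0`
(`hasDerivAt_twistedRotation_fst`, `hasDerivAt_twistedRotation_snd`) and affine for `E = 0`. By
uniqueness, an integral curve carries `(L, A)` along `(L*(sε), A*(sε))`
(`elements_integralCurve`).

Position and velocity are recovered from `L`, `A`, `|r|` and `r · v` in the orthogonal frame `A`,
`L × A`, where `A ≠ 0` because `r · v ≠ 0` (`orbitPos_elements`, `orbitVel_elements`). The square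
`(r · v)² = |r|²|v|² - |L|²` is `|r|²` times the radicand, and `r · v` keeps its sign on an integral
curve, so the explicit form follows and the radicand is positive along the curve. The time
component is the integral of the gauge function.

Conversely, if the radicand stays positive, the explicit formulas define a differentiable curve
with the elements `L*(sε)`, `A*(sε)` and constant `|r|` and `|v|`. Its velocity is the generator:
both change `L`, `A`, `|r|` and `|v|` in the same way, and these functions together have injective
differential where `r · v ≠ 0` (`eq_zero_of_elements_stationary`). Thus the derivatives of the
explicit formulas need not be computed (`hasDerivWithinAt_orbit_star`).
-/

namespace Kepler

/-! ### Vector algebra -/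

lemma cross_smul_right (c : ℝ) (a b : E3) : cross a (c • b) = c • cross a b := by
  ext i
  fin_cases i <;> simp [cross]

lemma cross_smul_left (c : ℝ) (a b : E3) : cross (c • a) b = c • cross a b := by
  ext i
  fin_cases i <;> simp [cross]

lemma cross_add_right (a b c : E3) : cross a (b + c) = cross a b + cross a c := by
  ext i
  fin_cases i <;> simp [cross, cross_apply] <;> ring

lemma cross_sub_right (a b c : E3) : cross a (b - c) = cross a b - cross a c := by
  ext i
  fin_cases i <;> simp [cross]

lemma cross_sub_left (a b c : E3) : cross (a - b) c = cross a c - cross b c := by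
  ext i
  fin_cases i <;> simp [cross]

lemma cross_add_left (a b c : E3) : cross (a + b) c = cross a c + cross b c := by
  ext i
  fin_cases i <;> simp [cross]

lemma cross_self (a : E3) : cross a a = 0 := by
  simp [cross]

lemma cross_anticomm (a b : E3) : cross a b = -cross b a := by
  ext i
  fin_cases i <;> simp [cross, cross_apply] <;> ring

lemma cross_cross (a b c : E3) : cross a (cross b c) = ⟪a, c⟫ • b - ⟪a, b⟫ • c := by
  ext i
  fin_cases i <;> simp [cross, cross_apply, inner_eq] <;> ring

lemma inner_cross_self_right (a b : E3) : ⟪b, cross a b⟫ = 0 := by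
  simp [cross, cross_apply, inner_eq]; ring

lemma inner_cross_swap (a b c : E3) : ⟪a, cross b c⟫ = -⟪c, cross b a⟫ := by
  simp [cross, cross_apply, inner_eq]; ring

lemma norm_cross_sq (a b : E3) : ‖cross a b‖ ^ 2 = ‖a‖ ^ 2 * ‖b‖ ^ 2 - ⟪a, b⟫ ^ 2 := by
  simp only [norm_sq_coords, inner_eq]
  simp [cross, cross_apply]; ring

/-- The cross product as a continuous bilinear map. -/
noncomputable def crossL : E3 →L[ℝ] E3 →L[ℝ] E3 := LinearMap.toContinuousBilinearMap
  (LinearMap.mk₂ ℝ cross cross_add_left cross_smul_left cross_add_right cross_smul_right)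

lemma crossL_apply (a b : E3) : crossL a b = cross a b := rfl

lemma continuousOn_cross {a b : ℝ → E3} {S : Set ℝ} (ha : ContinuousOn a S)
    (hb : ContinuousOn b S) : ContinuousOn (fun s => cross (a s) (b s)) S := by
  simp only [← crossL_apply]
  exact (crossL.continuous.comp_continuousOn ha).clm_apply hb

lemma hasDerivWithinAt_cross {a b : ℝ → E3} {a' b' : E3} {S : Set ℝ} {s : ℝ}
    (ha : HasDerivWithinAt a a' S s) (hb : HasDerivWithinAt b b' S s) :
    HasDerivWithinAt (fun u => cross (a u) (b u)) (cross a' (b s) + cross (a s) b') S s := by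
  simp only [← crossL_apply]
  rw [add_comm]
  exact crossL.hasDerivWithinAt_of_bilinear ha hb

/-! ### Elements of a Kepler orbit -/

lemma energy_mul_two (κ : ℝ) (r v : E3) : ‖v‖ ^ 2 = 2 * (energy κ r v + κ / ‖r‖) := by
  simp only [energy]; ring

lemma norm_angMom_sq (r v : E3) : ‖angMom r v‖ ^ 2 = ‖r‖ ^ 2 * ‖v‖ ^ 2 - ⟪r, v⟫ ^ 2 :=
  norm_cross_sq r v

lemma inner_angMom_lrl (κ : ℝ) (r v : E3) : ⟪angMom r v, lrl κ r v⟫ = 0 := by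
  rw [lrl_eq]
  simp only [angMom, inner_eq]
  simp [cross, cross_apply]; ring

lemma norm_lrl_sq (κ : ℝ) {r : E3} (v : E3) (hr : r ≠ 0) :
    ‖lrl κ r v‖ ^ 2 = κ ^ 2 + 2 * energy κ r v * ‖angMom r v‖ ^ 2 := by
  have hn : ‖r‖ ≠ 0 := norm_ne_zero_iff.mpr hr
  have h : ‖lrl κ r v‖ ^ 2
      = (‖v‖ ^ 2 - κ / ‖r‖) ^ 2 * ‖r‖ ^ 2 + ⟪r, v⟫ ^ 2 * ‖v‖ ^ 2
        - 2 * (‖v‖ ^ 2 - κ / ‖r‖) * ⟪r, v⟫ ^ 2 := by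
    rw [lrl_eq, real_inner_self_eq_norm_sq]
    generalize κ / ‖r‖ = q
    simp only [norm_sq_coords, inner_eq]
    simp only [PiLp.sub_apply, PiLp.smul_apply, smul_eq_mul]
    ring
  rw [h, norm_angMom_sq, energy]
  field_simp
  ring

/-- The Laplace-Runge-Lenz vector does not vanish where `r · v ≠ 0`: its component along `v` is
`-κ (r · v) / |r|`. -/
lemma lrl_ne_zero {κ : ℝ} (hκ : 0 < κ) {r v : E3} (h : ⟪r, v⟫ ≠ 0) : lrl κ r v ≠ 0 := by
  intro h0
  have hr : r ≠ 0 := by rintro rfl; simp at h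
  have hn : ‖r‖ ≠ 0 := norm_ne_zero_iff.mpr hr
  have h1 : ⟪v, lrl κ r v⟫ = -(κ / ‖r‖ * ⟪r, v⟫) := by
    rw [lrl_eq]
    simp only [inner_sub_right, inner_smul_right, real_inner_comm r v]
    ring
  rw [h0, inner_zero_right] at h1
  have : κ / ‖r‖ * ⟪r, v⟫ ≠ 0 := mul_ne_zero (div_ne_zero hκ.ne' hn) h
  exact this (by linarith)

/-- The position with orbital elements `L` and `A` that has distance `R` from the origin and
`r · v = g`. -/
noncomputable def orbitPos (κ R g : ℝ) (L A : E3) : E3 :=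
  (‖A‖ ^ 2)⁻¹ • ((‖L‖ ^ 2 - κ * R) • A + g • cross L A)

/-- The velocity with orbital elements `E`, `L`, `A` at distance `R` from the origin with
`r · v = g`. -/
noncomputable def orbitVel (κ E R g : ℝ) (L A : E3) : E3 :=
  (‖A‖ ^ 2)⁻¹ • ((-(κ * g / R)) • A + (2 * E + κ / R) • cross L A)

lemma cross_angMom_lrl (κ : ℝ) (r v : E3) :
    cross (angMom r v) (lrl κ r v) = (κ / ‖r‖ * ⟪r, v⟫) • r
      + ((‖v‖ ^ 2 - κ / ‖r‖) * ‖r‖ ^ 2 - ⟪r, v⟫ ^ 2) • v := by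
  rw [lrl_eq]
  generalize κ / ‖r‖ = q
  ext i
  fin_cases i <;>
    simp [angMom, cross, inner_eq, norm_sq_coords, cross_apply] <;> ring

/-- A phase space point is recovered from its orbital elements, its distance from the origin and
`r · v`. -/
lemma orbitPos_elements (κ : ℝ) {r v : E3} (hr : r ≠ 0) (hA : lrl κ r v ≠ 0) :
    orbitPos κ ‖r‖ ⟪r, v⟫ (angMom r v) (lrl κ r v) = r := by
  have hn : ‖r‖ ≠ 0 := norm_ne_zero_iff.mpr hr
  have hA' : ‖lrl κ r v‖ ^ 2 ≠ 0 := pow_ne_zero 2 (norm_ne_zero_iff.mpr hA)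
  rw [orbitPos, inv_smul_eq_iff₀ hA', norm_lrl_sq κ v hr, norm_angMom_sq, cross_angMom_lrl,
    lrl_eq, energy, real_inner_self_eq_norm_sq]
  match_scalars <;> field_simp <;> ring

/-- The velocity is recovered from the orbital elements, the distance from the origin and
`r · v`. -/
lemma orbitVel_elements (κ : ℝ) {r v : E3} (hr : r ≠ 0) (hA : lrl κ r v ≠ 0) :
    orbitVel κ (energy κ r v) ‖r‖ ⟪r, v⟫ (angMom r v) (lrl κ r v) = v := by
  have hn : ‖r‖ ≠ 0 := norm_ne_zero_iff.mpr hr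
  have hA' : ‖lrl κ r v‖ ^ 2 ≠ 0 := pow_ne_zero 2 (norm_ne_zero_iff.mpr hA)
  rw [orbitVel, inv_smul_eq_iff₀ hA', norm_lrl_sq κ v hr, norm_angMom_sq, cross_angMom_lrl,
    lrl_eq, energy, real_inner_self_eq_norm_sq]
  match_scalars <;> field_simp <;> ring

/-- The inner product of two vectors in the orthogonal frame `A`, `L × A`. -/
lemma inner_orbit_frame {L A : E3} (hLA : ⟪L, A⟫ = 0) (a b c d : ℝ) :
    ⟪a • A + b • cross L A, c • A + d • cross L A⟫ = (a * c + b * d * ‖L‖ ^ 2) * ‖A‖ ^ 2 := by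
  have h : ‖cross L A‖ ^ 2 = ‖L‖ ^ 2 * ‖A‖ ^ 2 := by rw [norm_cross_sq, hLA]; ring
  have h' : ⟪cross L A, A⟫ = 0 := by rw [real_inner_comm]; exact inner_cross_self_right L A
  simp only [inner_add_left, inner_add_right, inner_smul_left, inner_smul_right,
    inner_cross_self_right, h', real_inner_self_eq_norm_sq, h]
  simp
  ring

/-- The cross product of two vectors in the orthogonal frame `A`, `L × A`. -/
lemma cross_orbit_frame {L A : E3} (hLA : ⟪L, A⟫ = 0) (a b c d : ℝ) :
    cross (a • A + b • cross L A) (c • A + d • cross L A) = ((a * d - b * c) * ‖A‖ ^ 2) • L := by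
  have h : cross (a • A + b • cross L A) (c • A + d • cross L A)
      = (a * d - b * c) • cross A (cross L A) := by
    simp only [cross_add_left, cross_add_right, cross_smul_left, cross_smul_right, cross_self,
      cross_anticomm (cross L A) A]
    module
  rw [h, cross_cross, real_inner_comm L A, hLA, real_inner_self_eq_norm_sq, zero_smul, sub_zero,
    smul_smul]

section Realization

variable {κ E R g : ℝ} {L A : E3}

lemma norm_orbitPos (hLA : ⟪L, A⟫ = 0) (hA : A ≠ 0) (hN : ‖A‖ ^ 2 = κ ^ 2 + 2 * E * ‖L‖ ^ 2)
    (hR : 0 < R) (hg : g ^ 2 = 2 * (E * R ^ 2 + κ * R) - ‖L‖ ^ 2) :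
    ‖orbitPos κ R g L A‖ = R := by
  have hA' : ‖A‖ ≠ 0 := norm_ne_zero_iff.mpr hA
  rw [← sq_eq_sq₀ (norm_nonneg _) hR.le, ← real_inner_self_eq_norm_sq, orbitPos,
    inner_smul_left, inner_smul_right, inner_orbit_frame hLA]
  simp only [RCLike.conj_to_real]
  field_simp
  linear_combination ‖L‖ ^ 2 * hg - R ^ 2 * hN

lemma inner_orbitPos_orbitVel (hLA : ⟪L, A⟫ = 0) (hA : A ≠ 0)
    (hN : ‖A‖ ^ 2 = κ ^ 2 + 2 * E * ‖L‖ ^ 2) (hR : 0 < R) :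
    ⟪orbitPos κ R g L A, orbitVel κ E R g L A⟫ = g := by
  have hA' : ‖A‖ ≠ 0 := norm_ne_zero_iff.mpr hA
  rw [orbitPos, orbitVel, inner_smul_left, inner_smul_right, inner_orbit_frame hLA]
  simp only [RCLike.conj_to_real]
  field_simp
  linear_combination -g * R * hN

lemma norm_orbitVel_sq (hLA : ⟪L, A⟫ = 0) (hA : A ≠ 0)
    (hN : ‖A‖ ^ 2 = κ ^ 2 + 2 * E * ‖L‖ ^ 2) (hR : 0 < R)
    (hg : g ^ 2 = 2 * (E * R ^ 2 + κ * R) - ‖L‖ ^ 2) :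
    ‖orbitVel κ E R g L A‖ ^ 2 = 2 * (E + κ / R) := by
  have hA' : ‖A‖ ≠ 0 := norm_ne_zero_iff.mpr hA
  rw [← real_inner_self_eq_norm_sq, orbitVel, inner_smul_left, inner_smul_right,
    inner_orbit_frame hLA]
  simp only [RCLike.conj_to_real]
  field_simp
  linear_combination κ ^ 2 * hg - 2 * R * (E * R + κ) * hN

lemma energy_orbit (hLA : ⟪L, A⟫ = 0) (hA : A ≠ 0)
    (hN : ‖A‖ ^ 2 = κ ^ 2 + 2 * E * ‖L‖ ^ 2) (hR : 0 < R)
    (hg : g ^ 2 = 2 * (E * R ^ 2 + κ * R) - ‖L‖ ^ 2) :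
    energy κ (orbitPos κ R g L A) (orbitVel κ E R g L A) = E := by
  rw [energy, norm_orbitVel_sq hLA hA hN hR hg, norm_orbitPos hLA hA hN hR hg]
  ring

lemma angMom_orbit (hLA : ⟪L, A⟫ = 0) (hA : A ≠ 0)
    (hN : ‖A‖ ^ 2 = κ ^ 2 + 2 * E * ‖L‖ ^ 2) (hR : 0 < R)
    (hg : g ^ 2 = 2 * (E * R ^ 2 + κ * R) - ‖L‖ ^ 2) :
    angMom (orbitPos κ R g L A) (orbitVel κ E R g L A) = L := by
  have hA' : ‖A‖ ≠ 0 := norm_ne_zero_iff.mpr hA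
  rw [angMom, orbitPos, orbitVel, cross_smul_left, cross_smul_right, cross_orbit_frame hLA,
    smul_smul, smul_smul]
  convert one_smul ℝ L using 2
  field_simp
  linear_combination κ * hg - R * hN

lemma lrl_orbit (hLA : ⟪L, A⟫ = 0) (hA : A ≠ 0)
    (hN : ‖A‖ ^ 2 = κ ^ 2 + 2 * E * ‖L‖ ^ 2) (hR : 0 < R)
    (hg : g ^ 2 = 2 * (E * R ^ 2 + κ * R) - ‖L‖ ^ 2) :
    lrl κ (orbitPos κ R g L A) (orbitVel κ E R g L A) = A := by
  have hA' : ‖A‖ ≠ 0 := norm_ne_zero_iff.mpr hA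
  rw [lrl_eq, norm_orbitPos hLA hA hN hR hg, real_inner_self_eq_norm_sq,
    norm_orbitVel_sq hLA hA hN hR hg, inner_orbitPos_orbitVel hLA hA hN hR, orbitPos, orbitVel]
  match_scalars
  · field_simp
    linear_combination κ * hg - R * hN
  · field_simp
    ring

end Realization

/-! ### The generator in terms of the orbital elements -/

/-- The angular momentum changes by `e × A` along the generator; the gauge term with coefficient
`w` drops out. -/
lemma cross_generator (κ w : ℝ) (e r v : E3) :
    cross (w • v + lrlP e r v) v
      + cross r (w • (-(κ / ‖r‖ ^ 3) • r) + lrlDtP κ e r v) = cross e (lrl κ r v) := by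
  rcases eq_or_ne r 0 with rfl | hr
  · ext i
    fin_cases i <;> simp [lrl_eq, lrlP, cross, cross_apply]
  have hsq : κ / ‖r‖ = κ / ‖r‖ ^ 3 * ‖r‖ ^ 2 := by
    have := norm_ne_zero_iff.mpr hr
    field_simp
  rw [lrl_eq, lrlDtP, hsq]
  generalize κ / ‖r‖ ^ 3 = q
  ext i
  fin_cases i <;>
    simp [lrlP, cross, inner_eq, norm_sq_coords, cross_apply] <;> ring

/-- The change of the Laplace-Runge-Lenz vector along the generator is `-2E e × L`, provided that
the generator leaves `|r|` and `|v|` invariant. -/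
lemma lrl_generator (κ w : ℝ) (e r v : E3) (hr : r ≠ 0)
    (h1 : ⟪r, w • v + lrlP e r v⟫ = 0)
    (h2 : ⟪v, w • (-(κ / ‖r‖ ^ 3) • r) + lrlDtP κ e r v⟫ = 0) :
    (‖v‖ ^ 2 - κ / ‖r‖) • (w • v + lrlP e r v)
      - (⟪r, w • (-(κ / ‖r‖ ^ 3) • r) + lrlDtP κ e r v⟫ + ⟪w • v + lrlP e r v, v⟫) • v
      - ⟪r, v⟫ • (w • (-(κ / ‖r‖ ^ 3) • r) + lrlDtP κ e r v)
      = (-(2 * energy κ r v)) • cross e (angMom r v) := by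
  have hsq : κ / ‖r‖ = κ / ‖r‖ ^ 3 * ‖r‖ ^ 2 := by
    have := norm_ne_zero_iff.mpr hr
    field_simp
  -- the change of `A` before the invariance of `|r|` and `|v|` is used
  have key : (‖v‖ ^ 2 - κ / ‖r‖) • (w • v + lrlP e r v)
      - (⟪r, w • (-(κ / ‖r‖ ^ 3) • r) + lrlDtP κ e r v⟫ + ⟪w • v + lrlP e r v, v⟫) • v
      - ⟪r, v⟫ • (w • (-(κ / ‖r‖ ^ 3) • r) + lrlDtP κ e r v)
      + (2 * ⟪v, w • (-(κ / ‖r‖ ^ 3) • r) + lrlDtP κ e r v⟫) • r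
      + (κ / ‖r‖ ^ 3 * ⟪r, w • v + lrlP e r v⟫) • r
      = (-(2 * energy κ r v)) • cross e (angMom r v) := by
    rw [energy, lrlDtP, hsq]
    generalize κ / ‖r‖ ^ 3 = q
    ext i
    fin_cases i <;>
      simp [lrlP, angMom, cross, inner_eq, norm_sq_coords, cross_apply] <;> ring
  rw [h1, h2] at key
  simpa using key

/-- With the gauge coefficient `w = τ · e` the generator leaves `|r|` invariant. -/
lemma inner_pos_generator {r v : E3} (t : ℝ) (e : E3) (h : ⟪r, v⟫ ≠ 0) :
    ⟪r, ⟪gauge (t, r, v), e⟫ • v + lrlP e r v⟫ = 0 := by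
  have hw : ⟪gauge (t, r, v), e⟫ * ⟪r, v⟫ = ⟪cross (angMom r v) r, e⟫ := by
    rw [gauge, inner_smul_left]
    simp only [RCLike.conj_to_real]
    field_simp
  rw [inner_add_right, inner_smul_right, hw]
  simp [lrlP, angMom, cross, inner_eq, cross_apply]
  ring

/-- A generator that leaves `|r|` invariant leaves `|v|` invariant, because it preserves the
energy. -/
lemma inner_vel_generator (κ w : ℝ) (e r v : E3) (hr : r ≠ 0)
    (h1 : ⟪r, w • v + lrlP e r v⟫ = 0) :
    ⟪v, w • (-(κ / ‖r‖ ^ 3) • r) + lrlDtP κ e r v⟫ = 0 := by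
  have hsq : κ / ‖r‖ = κ / ‖r‖ ^ 3 * ‖r‖ ^ 2 := by
    have := norm_ne_zero_iff.mpr hr
    field_simp
  have key : ⟪v, w • (-(κ / ‖r‖ ^ 3) • r) + lrlDtP κ e r v⟫
      = -(κ / ‖r‖ ^ 3 * ⟪r, w • v + lrlP e r v⟫) := by
    rw [lrlDtP, hsq]
    generalize κ / ‖r‖ ^ 3 = q
    simp [lrlP, inner_eq, norm_sq_coords]
    ring
  rw [key, h1]
  ring

/-- The orbital elements, `|r|` and `|v|` together have injective differential where
`r · v ≠ 0`. -/
lemma eq_zero_of_elements_stationary {κ : ℝ} (hκ : 0 < κ) {r v x y : E3} (h : ⟪r, v⟫ ≠ 0)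
    (hL : cross x v + cross r y = 0)
    (hA : (‖v‖ ^ 2 - κ / ‖r‖) • x - (⟪r, y⟫ + ⟪x, v⟫) • v - ⟪r, v⟫ • y = 0)
    (hr : ⟪r, x⟫ = 0) (hv : ⟪v, y⟫ = 0) : x = 0 ∧ y = 0 := by
  have hr0 : r ≠ 0 := by rintro rfl; simp at h
  have hn : 0 < ‖r‖ := norm_pos_iff.mpr hr0
  have hq : κ / ‖r‖ ≠ 0 := (div_pos hκ hn).ne'
  have e1 : ‖v‖ ^ 2 • x - ⟪v, x⟫ • v + (⟪v, y⟫ • r - ⟪r, v⟫ • y) = 0 := by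
    have := congrArg (cross v) hL
    rw [cross_add_right, cross_cross, cross_cross, real_inner_self_eq_norm_sq,
      real_inner_comm r v] at this
    rw [this]
    simp [cross]
  rw [hv, zero_smul, zero_sub] at e1
  -- `v × δL - δA` is a combination of `x` and `v` alone
  have e2 : (κ / ‖r‖) • x = -(⟪r, y⟫ • v) := by
    have h3 := congrArg₂ (fun a b : E3 => a - b) e1 hA
    simp only [sub_self] at h3
    rw [real_inner_comm v x] at h3
    rw [← sub_eq_zero, ← h3]
    module
  have e3 : ⟪r, y⟫ = 0 := by
    have := congrArg (fun a : E3 => ⟪r, a⟫) e2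
    simp only [inner_smul_right, inner_neg_right, hr, mul_zero] at this
    have h4 : ⟪r, y⟫ * ⟪r, v⟫ = 0 := by linarith
    exact (mul_eq_zero.mp h4).resolve_right h
  have hx : x = 0 := by
    rw [e3, zero_smul, neg_zero] at e2
    exact (smul_eq_zero.mp e2).resolve_left hq
  refine ⟨hx, ?_⟩
  rw [hx, smul_zero, inner_zero_right, zero_smul, sub_zero, zero_add, neg_eq_zero] at e1
  exact (smul_eq_zero.mp e1).resolve_left h

/-! ### The twisted rotation as a linear flow -/

lemma hasDerivAt_cosE {E : ℝ} (hE : E ≠ 0) (φ : ℝ) :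
    HasDerivAt (cosE E) (Real.sign E * sinE E φ) φ := by
  rcases lt_or_gt_of_ne hE with h | h
  · have : cosE E = Real.cos := by funext x; simp [cosE, h]
    rw [this, sinE, if_pos h, Real.sign_of_neg h]
    simpa using Real.hasDerivAt_cos φ
  · have : cosE E = Real.cosh := by funext x; simp [cosE, h.not_gt]
    rw [this, sinE, if_neg h.not_gt, Real.sign_of_pos h]
    simpa using Real.hasDerivAt_cosh φ

lemma hasDerivAt_sinE (E φ : ℝ) : HasDerivAt (sinE E) (cosE E φ) φ := by
  by_cases h : E < 0
  · have : sinE E = Real.sin := by funext x; simp [sinE, h]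
    rw [this, cosE, if_pos h]
    exact Real.hasDerivAt_sin φ
  · have : sinE E = Real.sinh := by funext x; simp [sinE, h]
    rw [this, cosE, if_neg h]
    exact Real.hasDerivAt_sinh φ

lemma twistedRotation_zero (E : ℝ) (n : E3) (p : E3 × E3) : twistedRotation E 0 n p = p := by
  have hc : cosE E 0 = 1 := by simp [cosE]
  have hs : sinE E 0 = 0 := by simp [sinE]
  simp [twistedRotation, hc, hs]

/-- The angular momentum component of the twisted rotation with linearly growing angle `ω s`
satisfies a linear differential equation. The axis may be zero if `ω` is. -/
lemma hasDerivAt_twistedRotation_fst {E : ℝ} (hE : E ≠ 0) {ω : ℝ} {n : E3}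
    (hn : ω = 0 ∨ ‖n‖ = 1) (p : E3 × E3) (s : ℝ) :
    HasDerivAt (fun u => (twistedRotation E (ω * u) n p).1)
      (ω • cross n (twistedRotation E (ω * s) n p).2) s := by
  have hω : HasDerivAt (fun u => ω * u) ω s := by simpa using (hasDerivAt_id s).const_mul ω
  have hc := (hasDerivAt_cosE hE (ω * s)).comp s hω
  have hs := (hasDerivAt_sinE E (ω * s)).comp s hω
  have h := ((hc.smul_const p.1).add (((hc.const_sub 1).mul_const ⟪n, p.1⟫).smul_const n)).add
    (hs.smul_const (cross n p.2))
  refine h.congr_deriv ?_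
  simp only [twistedRotation, cross_add_right, cross_sub_right, cross_smul_right, cross_self,
    cross_cross, real_inner_self_eq_norm_sq]
  rcases hn with rfl | hn
  · simp
  · rw [hn]; module

/-- The second component of the twisted rotation with linearly growing angle `ω s` satisfies a
linear differential equation. The axis may be zero if `ω` is. -/
lemma hasDerivAt_twistedRotation_snd {E : ℝ} (hE : E ≠ 0) {ω : ℝ} {n : E3}
    (hn : ω = 0 ∨ ‖n‖ = 1) (p : E3 × E3) (s : ℝ) :
    HasDerivAt (fun u => (twistedRotation E (ω * u) n p).2)
      ((-(Real.sign E * ω)) • cross n (twistedRotation E (ω * s) n p).1) s := by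
  have hω : HasDerivAt (fun u => ω * u) ω s := by simpa using (hasDerivAt_id s).const_mul ω
  have hc := (hasDerivAt_cosE hE (ω * s)).comp s hω
  have hs := (hasDerivAt_sinE E (ω * s)).comp s hω
  have h := ((hc.smul_const p.2).add (((hc.const_sub 1).mul_const ⟪n, p.2⟫).smul_const n)).sub
    ((hs.const_mul (Real.sign E)).smul_const (cross n p.1))
  refine h.congr_deriv ?_
  simp only [twistedRotation, cross_add_right, cross_smul_right, cross_self,
    cross_cross, real_inner_self_eq_norm_sq]
  rcases hn with rfl | hn
  · simp
  · rw [hn]; module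

/-- The angle and axis assigned to `s • ε` for `s ≥ 0` are `√(2|E|) |ε| s` and the direction of
`ε`; at `s = 0`, where the direction is the junk value `0`, the angle vanishes. -/
lemma rotatedLM_smul (κ : ℝ) (r v ε : E3) {s : ℝ} (hs : 0 ≤ s) :
    rotatedLM κ r v (s • ε)
      = twistedRotation (energy κ r v) ((√(2 * |energy κ r v|) * ‖ε‖) * s) (‖ε‖⁻¹ • ε)
          (angMom r v, lrlM κ r v) := by
  rcases hs.eq_or_lt with rfl | hs
  · simp [rotatedLM, twistedRotation_zero]
  · have h1 : ‖s • ε‖ = s * ‖ε‖ := by rw [norm_smul, Real.norm_of_nonneg hs.le]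
    have h2 : (s * ‖ε‖)⁻¹ • s • ε = ‖ε‖⁻¹ • ε := by
      rw [smul_smul]
      congr 1
      rw [mul_inv]
      field_simp
    rw [rotatedLM, h1, h2]
    congr 1
    ring

/-- The explicit transformed Laplace-Runge-Lenz vector. -/
noncomputable def starLRL (κ : ℝ) (r v ε : E3) : E3 :=
  if energy κ r v = 0 then lrl κ r v
  else √(2 * |energy κ r v|) • (rotatedLM κ r v ε).2

section Star

variable {κ : ℝ} {r v : E3}

lemma sqrt_two_mul_abs_pos {E : ℝ} (hE : E ≠ 0) : 0 < √(2 * |E|) := by positivity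

lemma sqrt_smul_lrlM (hE : energy κ r v ≠ 0) :
    √(2 * |energy κ r v|) • lrlM κ r v = lrl κ r v := by
  rw [lrlM, smul_smul, mul_inv_cancel₀ (sqrt_two_mul_abs_pos hE).ne', one_smul]

lemma norm_smul_lrlDir (κ : ℝ) (r v : E3) : ‖lrl κ r v‖ • lrlDir κ r v = lrl κ r v := by
  by_cases h : lrl κ r v = 0
  · simp [h]
  · rw [lrlDir, smul_smul, mul_inv_cancel₀ (norm_ne_zero_iff.mpr h), one_smul]

lemma starL_zero (κ : ℝ) (r v : E3) : starL κ r v 0 = angMom r v := by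
  by_cases hE : energy κ r v = 0
  · simp [starL, hE, cross]
  · simp [starL, hE, rotatedLM, twistedRotation_zero]

lemma starLRL_zero (κ : ℝ) (r v : E3) : starLRL κ r v 0 = lrl κ r v := by
  by_cases hE : energy κ r v = 0
  · simp [starLRL, hE]
  · rw [starLRL, if_neg hE, rotatedLM, norm_zero, mul_zero, twistedRotation_zero,
      sqrt_smul_lrlM hE]

/-- The rotation axis is a unit vector unless `ε = 0`, when the angle vanishes. -/
lemma angle_eq_zero_or_norm_axis_eq_one (κ : ℝ) (r v ε : E3) :
    √(2 * |energy κ r v|) * ‖ε‖ = 0 ∨ ‖‖ε‖⁻¹ • ε‖ = 1 := by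
  by_cases h : ε = 0
  · simp [h]
  · right
    rw [norm_smul, norm_inv, norm_norm, inv_mul_cancel₀ (norm_ne_zero_iff.mpr h)]

lemma norm_mul_cross_axis (ε a : E3) : ‖ε‖ • cross (‖ε‖⁻¹ • ε) a = cross ε a := by
  by_cases h : ε = 0
  · simp [h, cross]
  · rw [cross_smul_left, smul_smul, mul_inv_cancel₀ (norm_ne_zero_iff.mpr h), one_smul]

/-- Along the ray of `ε` the pair `(L*, A*)` solves the equation `L' = ε × A`. -/
lemma hasDerivWithinAt_starL (κ : ℝ) (r v ε : E3) {s : ℝ} (hs : s ∈ Icc (0 : ℝ) 1) :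
    HasDerivWithinAt (fun u : ℝ => starL κ r v (u • ε)) (cross ε (starLRL κ r v (s • ε)))
      (Icc 0 1) s := by
  by_cases hE : energy κ r v = 0
  · simp only [starL, starLRL, if_pos hE, cross_smul_left]
    have h := (((hasDerivAt_id s).smul_const (cross ε (lrlDir κ r v))).const_smul
      ‖lrl κ r v‖).const_add (angMom r v)
    refine (h.congr_deriv ?_).hasDerivWithinAt
    rw [one_smul, ← cross_smul_right, norm_smul_lrlDir]
  · simp only [starL, starLRL, if_neg hE]
    have h := (hasDerivAt_twistedRotation_fst hE (angle_eq_zero_or_norm_axis_eq_one κ r v ε)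
      (angMom r v, lrlM κ r v) s).hasDerivWithinAt (s := Icc 0 1)
    refine (h.congr (fun u hu => by rw [rotatedLM_smul κ r v ε hu.1])
      (by rw [rotatedLM_smul κ r v ε hs.1])).congr_deriv ?_
    rw [mul_smul, norm_mul_cross_axis, cross_smul_right, rotatedLM_smul κ r v ε hs.1]

/-- Along the ray of `ε` the pair `(L*, A*)` solves the equation `A' = -2E ε × L`. -/
lemma hasDerivWithinAt_starLRL (κ : ℝ) (r v ε : E3) {s : ℝ} (hs : s ∈ Icc (0 : ℝ) 1) :
    HasDerivWithinAt (fun u : ℝ => starLRL κ r v (u • ε))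
      ((-(2 * energy κ r v)) • cross ε (starL κ r v (s • ε))) (Icc 0 1) s := by
  by_cases hE : energy κ r v = 0
  · simp only [starLRL, if_pos hE]
    simp only [hE, mul_zero, neg_zero, zero_smul]
    exact hasDerivWithinAt_const _ _ _
  · simp only [starL, starLRL, if_neg hE]
    have h := ((hasDerivAt_twistedRotation_snd hE (angle_eq_zero_or_norm_axis_eq_one κ r v ε)
      (angMom r v, lrlM κ r v) s).hasDerivWithinAt (s := Icc 0 1)).const_smul
        √(2 * |energy κ r v|)
    refine (h.congr (fun u hu => by rw [rotatedLM_smul κ r v ε hu.1]; rfl)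
      (by rw [rotatedLM_smul κ r v ε hs.1]; rfl)).congr_deriv ?_
    have h2 : √(2 * |energy κ r v|) * √(2 * |energy κ r v|) = 2 * |energy κ r v| :=
      Real.mul_self_sqrt (by positivity)
    have h3 : Real.sign (energy κ r v) * |energy κ r v| = energy κ r v := by
      rcases lt_or_gt_of_ne hE with h | h
      · rw [Real.sign_of_neg h, abs_of_neg h]; ring
      · rw [Real.sign_of_pos h, abs_of_pos h]; ring
    rw [rotatedLM_smul κ r v ε hs.1, ← norm_mul_cross_axis ε, smul_smul, smul_smul]
    congr 1
    linear_combination (-Real.sign (energy κ r v) * ‖ε‖) * h2 - 2 * ‖ε‖ * h3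

/-- A quantity with vanishing derivative on the unit interval is constant there. -/
lemma eq_of_hasDerivWithinAt_zero {F : Type*} [NormedAddCommGroup F] [NormedSpace ℝ F]
    {f : ℝ → F} (h : ∀ s ∈ Icc (0 : ℝ) 1, HasDerivWithinAt f 0 (Icc 0 1) s) {s : ℝ}
    (hs : s ∈ Icc (0 : ℝ) 1) : f s = f 0 :=
  constant_of_derivWithin_zero (fun x hx => (h x hx).differentiableWithinAt)
    (fun x hx => (h x (Ico_subset_Icc_self hx)).derivWithin
      (uniqueDiffOn_Icc zero_lt_one x (Ico_subset_Icc_self hx))) s hs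

lemma inner_starL_starLRL (κ : ℝ) (r v ε : E3) : ⟪starL κ r v ε, starLRL κ r v ε⟫ = 0 := by
  have h : ∀ s ∈ Icc (0 : ℝ) 1, HasDerivWithinAt
      (fun u : ℝ => ⟪starL κ r v (u • ε), starLRL κ r v (u • ε)⟫) 0 (Icc 0 1) s := by
    intro s hs
    refine ((hasDerivWithinAt_starL κ r v ε hs).inner ℝ
      (hasDerivWithinAt_starLRL κ r v ε hs)).congr_deriv ?_
    rw [inner_smul_right, inner_cross_self_right, real_inner_comm, inner_cross_self_right]
    simp
  have := eq_of_hasDerivWithinAt_zero h (right_mem_Icc.mpr zero_le_one)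
  simp only [one_smul, zero_smul] at this
  rw [this, starL_zero, starLRL_zero, inner_angMom_lrl]

lemma norm_starLRL_sq (hr : r ≠ 0) (ε : E3) :
    ‖starLRL κ r v ε‖ ^ 2 = κ ^ 2 + 2 * energy κ r v * ‖starL κ r v ε‖ ^ 2 := by
  have h : ∀ s ∈ Icc (0 : ℝ) 1, HasDerivWithinAt
      (fun u : ℝ => ‖starLRL κ r v (u • ε)‖ ^ 2
        - 2 * energy κ r v * ‖starL κ r v (u • ε)‖ ^ 2) 0 (Icc 0 1) s := by
    intro s hs
    refine ((hasDerivWithinAt_starLRL κ r v ε hs).norm_sq.sub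
      ((hasDerivWithinAt_starL κ r v ε hs).norm_sq.const_mul (2 * energy κ r v))).congr_deriv ?_
    rw [inner_smul_right, inner_cross_swap]
    ring
  have := eq_of_hasDerivWithinAt_zero h (right_mem_Icc.mpr zero_le_one)
  simp only [one_smul, zero_smul] at this
  rw [starL_zero, starLRL_zero, norm_lrl_sq κ v hr] at this
  linarith

lemma starA_eq (hr : r ≠ 0) (ε : E3) : starA κ r v ε = ‖starLRL κ r v ε‖ := by
  rw [starA, ← norm_starLRL_sq hr, Real.sqrt_sq (norm_nonneg _)]

lemma starTheta_eq (κ : ℝ) (r v ε : E3) :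
    starTheta κ r v ε = ‖starLRL κ r v ε‖⁻¹ • starLRL κ r v ε := by
  by_cases hE : energy κ r v = 0
  · simp only [starTheta, starLRL, if_pos hE, lrlDir]
  · simp only [starTheta, starLRL, if_neg hE]
    have h := sqrt_two_mul_abs_pos hE
    rw [norm_smul, Real.norm_of_nonneg h.le, smul_smul, mul_inv]
    congr 1
    field_simp

/-- The transformed Laplace-Runge-Lenz vector does not vanish as long as the squared radial
velocity is positive. -/
lemma starLRL_ne_zero (hκ : 0 < κ) (hr : r ≠ 0) {ε : E3} (h : 0 < starRadicand κ r v ε) :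
    starLRL κ r v ε ≠ 0 := by
  have hR : 0 < ‖r‖ := norm_pos_iff.mpr hr
  have hN := norm_starLRL_sq (κ := κ) (v := v) hr ε
  have h1 : ‖starL κ r v ε‖ ^ 2 < 2 * (energy κ r v * ‖r‖ ^ 2 + κ * ‖r‖) := by
    have := mul_pos h (pow_pos hR 2)
    rw [starRadicand] at this
    field_simp at this
    nlinarith
  have : 0 < ‖starLRL κ r v ε‖ ^ 2 := by
    rw [hN]
    rcases lt_or_ge (energy κ r v) 0 with hE | hE
    · -- `κ² + 2E|L*|² > (κ + 2E|r|)²`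
      nlinarith [sq_nonneg (κ + 2 * energy κ r v * ‖r‖), mul_pos_of_neg_of_neg hE (sub_neg.mpr h1)]
    · positivity
  intro h0
  simp [h0] at this

lemma starRV_sq (hrv : ⟪r, v⟫ ≠ 0) {ε : E3} (h : 0 ≤ starRadicand κ r v ε) :
    starRV κ r v ε ^ 2 = 2 * (energy κ r v * ‖r‖ ^ 2 + κ * ‖r‖) - ‖starL κ r v ε‖ ^ 2 := by
  have hr : r ≠ 0 := by rintro rfl; simp at hrv
  have hR : 0 < ‖r‖ := norm_pos_iff.mpr hr
  have hs : Real.sign ⟪r, v⟫ ^ 2 = 1 := by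
    rcases Real.sign_apply_eq_of_ne_zero _ hrv with h | h <;> rw [h] <;> norm_num
  rw [starRV, mul_pow, mul_pow, Real.sq_sqrt h, hs, starRadicand]
  field_simp

/-- The formula for the transformed position in terms of `L*` and `A*`. -/
lemma orbitPos_star (hr : r ≠ 0) (ε : E3) :
    orbitPos κ ‖r‖ (starRV κ r v ε) (starL κ r v ε) (starLRL κ r v ε)
      = alphaR κ r v ε • starTheta κ r v ε
        + betaR κ r v ε • cross (starL κ r v ε) (starTheta κ r v ε) := by
  rw [alphaR, betaR, starTheta_eq, starA_eq hr, cross_smul_right, orbitPos, starRV]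
  match_scalars <;> ring

/-- The formula for the transformed velocity in terms of `L*` and `A*`. -/
lemma orbitVel_star (hr : r ≠ 0) (ε : E3) :
    orbitVel κ (energy κ r v) ‖r‖ (starRV κ r v ε) (starL κ r v ε) (starLRL κ r v ε)
      = alphaV κ r v ε • starTheta κ r v ε
        + betaV κ r v ε • cross (starL κ r v ε) (starTheta κ r v ε) := by
  have hR : ‖r‖ ≠ 0 := norm_ne_zero_iff.mpr hr
  rw [alphaV, betaV, starTheta_eq, starA_eq hr, cross_smul_right, orbitVel, starRV]
  match_scalars
  · field_simp
  · ring

/-- The integrand of the quadrature is the gauge function at the transformed point: in both,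
`L × r` is divided by `r · v`. -/
lemma starTau_eq (hr : r ≠ 0) (ε : E3) :
    starTau κ r v ε = (starRV κ r v ε)⁻¹ • cross (starL κ r v ε)
      (orbitPos κ ‖r‖ (starRV κ r v ε) (starL κ r v ε) (starLRL κ r v ε)) := by
  have h0 : ⟪starL κ r v ε, starTheta κ r v ε⟫ = 0 := by
    rw [starTheta_eq, inner_smul_right, inner_starL_starLRL, mul_zero]
  rw [orbitPos_star hr, starTau, cross_add_right, cross_smul_right, cross_smul_right, cross_cross,
    h0, real_inner_self_eq_norm_sq]
  congr 1
  module

end Star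

/-! ### Derivatives along curves -/

/-- The derivative of the Laplace-Runge-Lenz vector along a curve on which `|x|` and `|y|` are
constant, so that only `x`, `y` and `⟪x, y⟫` have to be differentiated. -/
lemma hasDerivWithinAt_lrl {κ : ℝ} {x y : ℝ → E3} {x' y' : E3} {S : Set ℝ} {s : ℝ} (hs : s ∈ S)
    (hx : HasDerivWithinAt x x' S s) (hy : HasDerivWithinAt y y' S s)
    (hnx : ∀ u ∈ S, ‖x u‖ = ‖x s‖) (hny : ∀ u ∈ S, ‖y u‖ = ‖y s‖) :
    HasDerivWithinAt (fun u => lrl κ (x u) (y u))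
      ((‖y s‖ ^ 2 - κ / ‖x s‖) • x' - (⟪x s, y'⟫ + ⟪x', y s⟫) • y s - ⟪x s, y s⟫ • y') S s := by
  have heq : ∀ u ∈ S, lrl κ (x u) (y u)
      = (‖y s‖ ^ 2 - κ / ‖x s‖) • x u - ⟪x u, y u⟫ • y u := by
    intro u hu
    rw [lrl_eq, real_inner_self_eq_norm_sq, hnx u hu, hny u hu]
    module
  refine (((hx.const_smul (‖y s‖ ^ 2 - κ / ‖x s‖)).sub ((hx.inner ℝ hy).smul hy)).congr heq
    (heq s hs)).congr_deriv ?_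
  module

lemma continuousOn_gauge {x y : ℝ → E3} {S : Set ℝ} (hx : ContinuousOn x S)
    (hy : ContinuousOn y S) (h : ∀ s ∈ S, ⟪x s, y s⟫ ≠ 0) (t : ℝ → ℝ) :
    ContinuousOn (fun s => gauge (t s, x s, y s)) S := by
  exact ((ContinuousOn.inner (𝕜 := ℝ) hx hy).inv₀ h).smul (continuousOn_cross (continuousOn_cross hx hy) hx)

/-- The equations `L' = ε × A`, `A' = -2E ε × L` determine `L` and `A` on the unit interval from
their initial values. -/
lemma elements_flow_unique {E : ℝ} {ε : E3} {L₁ A₁ L₂ A₂ : ℝ → E3}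
    (hL₁ : ∀ s ∈ Icc (0 : ℝ) 1, HasDerivWithinAt L₁ (cross ε (A₁ s)) (Icc 0 1) s)
    (hA₁ : ∀ s ∈ Icc (0 : ℝ) 1,
      HasDerivWithinAt A₁ ((-(2 * E)) • cross ε (L₁ s)) (Icc 0 1) s)
    (hL₂ : ∀ s ∈ Icc (0 : ℝ) 1, HasDerivWithinAt L₂ (cross ε (A₂ s)) (Icc 0 1) s)
    (hA₂ : ∀ s ∈ Icc (0 : ℝ) 1,
      HasDerivWithinAt A₂ ((-(2 * E)) • cross ε (L₂ s)) (Icc 0 1) s)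
    (hL : L₁ 0 = L₂ 0) (hA : A₁ 0 = A₂ 0) {s : ℝ} (hs : s ∈ Icc (0 : ℝ) 1) :
    L₁ s = L₂ s ∧ A₁ s = A₂ s := by
  have hlin : IsLinearMap ℝ
      (fun p : E3 × E3 => (cross ε p.2, (-(2 * E)) • cross ε p.1)) := by
    constructor
    · intro p q
      simp [cross_add_right]
    · intro c p
      simp [cross_smul_right, smul_comm c]
  let Λ : E3 × E3 →L[ℝ] E3 × E3 := LinearMap.toContinuousLinearMap (hlin.mk' _)
  have hIci : ∀ {f : ℝ → E3 × E3} {f' : E3 × E3} {u : ℝ}, u ∈ Ico (0 : ℝ) 1 →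
      HasDerivWithinAt f f' (Icc 0 1) u → HasDerivWithinAt f f' (Ici u) u := by
    intro f f' u hu h
    refine (h.mono (Icc_subset_Icc_left hu.1)).mono_of_mem_nhdsWithin ?_
    exact Icc_mem_nhdsGE hu.2
  have h1 : ∀ u ∈ Icc (0 : ℝ) 1,
      HasDerivWithinAt (fun u => (L₁ u, A₁ u)) (Λ (L₁ u, A₁ u)) (Icc 0 1) u :=
    fun u hu => (hL₁ u hu).prodMk (hA₁ u hu)
  have h2 : ∀ u ∈ Icc (0 : ℝ) 1,
      HasDerivWithinAt (fun u => (L₂ u, A₂ u)) (Λ (L₂ u, A₂ u)) (Icc 0 1) u :=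
    fun u hu => (hL₂ u hu).prodMk (hA₂ u hu)
  have h := ODE_solution_unique (v := fun _ => Λ) (fun _ => Λ.lipschitz)
    (fun u hu => (h1 u hu).continuousWithinAt)
    (fun u hu => hIci hu (h1 u (Ico_subset_Icc_self hu)))
    (fun u hu => (h2 u hu).continuousWithinAt)
    (fun u hu => hIci hu (h2 u (Ico_subset_Icc_self hu))) (by simp only [hL, hA]) hs
  simpa using h

/-! ### Integral curves of the generator -/

section IntegralCurve

variable {κ : ℝ} {ε : E3} {γ : ℝ → State}

lemma hasDerivWithinAt_time {s : ℝ} {S : Set ℝ}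
    (h : HasDerivWithinAt γ (lrlY κ gauge ε (γ s)) S s) :
    HasDerivWithinAt (fun u => (γ u).1) ⟪gauge (γ s), ε⟫ S s := by
  have := (ContinuousLinearMap.fst ℝ ℝ (E3 × E3)).hasFDerivAt.comp_hasDerivWithinAt s h
  refine this.congr_deriv ?_
  simp [lrlY, totalD]

lemma hasDerivWithinAt_pos {s : ℝ} {S : Set ℝ}
    (h : HasDerivWithinAt γ (lrlY κ gauge ε (γ s)) S s) :
    HasDerivWithinAt (fun u => (γ u).2.1)
      (⟪gauge (γ s), ε⟫ • (γ s).2.2 + lrlP ε (γ s).2.1 (γ s).2.2) S s := by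
  have := ((ContinuousLinearMap.fst ℝ E3 E3).comp
    (ContinuousLinearMap.snd ℝ ℝ (E3 × E3))).hasFDerivAt.comp_hasDerivWithinAt s h
  exact this

lemma hasDerivWithinAt_vel {s : ℝ} {S : Set ℝ}
    (h : HasDerivWithinAt γ (lrlY κ gauge ε (γ s)) S s) :
    HasDerivWithinAt (fun u => (γ u).2.2)
      (⟪gauge (γ s), ε⟫ • (-(κ / ‖(γ s).2.1‖ ^ 3) • (γ s).2.1)
        + lrlDtP κ ε (γ s).2.1 (γ s).2.2) S s := by
  have := ((ContinuousLinearMap.snd ℝ E3 E3).comp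
    (ContinuousLinearMap.snd ℝ ℝ (E3 × E3))).hasFDerivAt.comp_hasDerivWithinAt s h
  exact this

lemma pos_ne_zero_of_mem_gaugeDomain {x : State} (h : x ∈ gaugeDomain) : x.2.1 ≠ 0 := by
  intro h0
  exact h (by rw [h0, inner_zero_left])

variable (hγ : ∀ s ∈ Icc (0 : ℝ) 1,
  γ s ∈ gaugeDomain ∧ HasDerivWithinAt γ (lrlY κ gauge ε (γ s)) (Icc 0 1) s)

include hγ

lemma norm_pos_integralCurve {s : ℝ} (hs : s ∈ Icc (0 : ℝ) 1) :
    ‖(γ s).2.1‖ = ‖(γ 0).2.1‖ := by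
  rw [← sq_eq_sq₀ (norm_nonneg _) (norm_nonneg _)]
  refine eq_of_hasDerivWithinAt_zero (f := fun u => ‖(γ u).2.1‖ ^ 2) (fun u hu => ?_) hs
  refine (hasDerivWithinAt_pos (hγ u hu).2).norm_sq.congr_deriv ?_
  rw [inner_pos_generator (γ u).1 ε (hγ u hu).1, mul_zero]

lemma norm_vel_integralCurve {s : ℝ} (hs : s ∈ Icc (0 : ℝ) 1) :
    ‖(γ s).2.2‖ = ‖(γ 0).2.2‖ := by
  rw [← sq_eq_sq₀ (norm_nonneg _) (norm_nonneg _)]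
  refine eq_of_hasDerivWithinAt_zero (f := fun u => ‖(γ u).2.2‖ ^ 2) (fun u hu => ?_) hs
  refine (hasDerivWithinAt_vel (hγ u hu).2).norm_sq.congr_deriv ?_
  rw [inner_vel_generator κ _ ε _ _ (pos_ne_zero_of_mem_gaugeDomain (hγ u hu).1)
    (inner_pos_generator (γ u).1 ε (hγ u hu).1), mul_zero]

lemma energy_integralCurve {s : ℝ} (hs : s ∈ Icc (0 : ℝ) 1) :
    energy κ (γ s).2.1 (γ s).2.2 = energy κ (γ 0).2.1 (γ 0).2.2 := by
  rw [energy, energy, norm_pos_integralCurve hγ hs, norm_vel_integralCurve hγ hs]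

/-- Along an integral curve the angular momentum and the Laplace-Runge-Lenz vector are `L*` and
`A*`. -/
lemma elements_integralCurve {s : ℝ} (hs : s ∈ Icc (0 : ℝ) 1) :
    angMom (γ s).2.1 (γ s).2.2 = starL κ (γ 0).2.1 (γ 0).2.2 (s • ε) ∧
      lrl κ (γ s).2.1 (γ s).2.2 = starLRL κ (γ 0).2.1 (γ 0).2.2 (s • ε) := by
  refine elements_flow_unique (L₁ := fun s => angMom (γ s).2.1 (γ s).2.2)
    (A₁ := fun s => lrl κ (γ s).2.1 (γ s).2.2) (fun u hu => ?_) (fun u hu => ?_)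
    (fun u hu => hasDerivWithinAt_starL κ (γ 0).2.1 (γ 0).2.2 ε hu)
    (fun u hu => hasDerivWithinAt_starLRL κ (γ 0).2.1 (γ 0).2.2 ε hu)
    (by simp only [zero_smul, starL_zero]) (by simp only [zero_smul, starLRL_zero]) hs
  · refine (hasDerivWithinAt_cross (hasDerivWithinAt_pos (hγ u hu).2)
      (hasDerivWithinAt_vel (hγ u hu).2)).congr_deriv ?_
    exact cross_generator κ _ ε _ _
  · have hr := pos_ne_zero_of_mem_gaugeDomain (hγ u hu).1
    have h1 := inner_pos_generator (γ u).1 ε (hγ u hu).1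
    refine (hasDerivWithinAt_lrl hu (hasDerivWithinAt_pos (hγ u hu).2)
      (hasDerivWithinAt_vel (hγ u hu).2)
      (fun w hw => (norm_pos_integralCurve hγ hw).trans (norm_pos_integralCurve hγ hu).symm)
      (fun w hw =>
        (norm_vel_integralCurve hγ hw).trans (norm_vel_integralCurve hγ hu).symm)).congr_deriv ?_
    rw [← energy_integralCurve hγ hu]
    exact lrl_generator κ _ ε _ _ hr h1 (inner_vel_generator κ _ ε _ _ hr h1)

lemma continuousOn_pos_integralCurve : ContinuousOn (fun s => (γ s).2.1) (Icc 0 1) :=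
  fun s hs => (hasDerivWithinAt_pos (hγ s hs).2).continuousWithinAt

lemma continuousOn_vel_integralCurve : ContinuousOn (fun s => (γ s).2.2) (Icc 0 1) :=
  fun s hs => (hasDerivWithinAt_vel (hγ s hs).2).continuousWithinAt

/-- Along an integral curve the squared radial velocity `(r · v)² / |r|²` has the explicit form
in terms of `L*`. -/
lemma starRadicand_integralCurve {s : ℝ} (hs : s ∈ Icc (0 : ℝ) 1) :
    starRadicand κ (γ 0).2.1 (γ 0).2.2 (s • ε)
      = (⟪(γ s).2.1, (γ s).2.2⟫ / ‖(γ 0).2.1‖) ^ 2 := by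
  have hR := norm_ne_zero_iff.mpr (pos_ne_zero_of_mem_gaugeDomain (hγ s hs).1)
  have h := norm_angMom_sq (γ s).2.1 (γ s).2.2
  have hE := energy_mul_two κ (γ s).2.1 (γ s).2.2
  rw [(elements_integralCurve hγ hs).1] at h
  rw [energy_integralCurve hγ hs] at hE
  rw [norm_pos_integralCurve hγ hs] at h hE hR
  rw [starRadicand, ← hE, div_pow, h]
  field_simp
  ring

lemma starRadicand_pos_integralCurve {s : ℝ} (hs : s ∈ Icc (0 : ℝ) 1) :
    0 < starRadicand κ (γ 0).2.1 (γ 0).2.2 (s • ε) := by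
  have hR := norm_ne_zero_iff.mpr
    (pos_ne_zero_of_mem_gaugeDomain (hγ 0 (left_mem_Icc.mpr zero_le_one)).1)
  rw [starRadicand_integralCurve hγ hs]
  have : ⟪(γ s).2.1, (γ s).2.2⟫ ≠ 0 := (hγ s hs).1
  positivity

/-- Along an integral curve `r · v` keeps its sign, so that it equals the explicit `r* · v*`. -/
lemma inner_integralCurve {s : ℝ} (hs : s ∈ Icc (0 : ℝ) 1) :
    ⟪(γ s).2.1, (γ s).2.2⟫ = starRV κ (γ 0).2.1 (γ 0).2.2 (s • ε) := by
  have h0 : (0 : ℝ) ∈ Icc (0 : ℝ) 1 := left_mem_Icc.mpr zero_le_one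
  have hR := norm_pos_iff.mpr (pos_ne_zero_of_mem_gaugeDomain (hγ 0 h0).1)
  have hc : ContinuousOn (fun u => ⟪(γ u).2.1, (γ u).2.2⟫) (Icc 0 1) :=
    (continuousOn_pos_integralCurve hγ).inner (continuousOn_vel_integralCurve hγ)
  have hzero : ∀ u ∈ Icc (0 : ℝ) 1, ⟪(γ u).2.1, (γ u).2.2⟫ ≠ 0 := fun u hu => (hγ u hu).1
  rw [starRV, starRadicand_integralCurve hγ hs, Real.sqrt_sq_eq_abs, abs_div, abs_norm]
  rcases lt_or_gt_of_ne (hzero 0 h0) with hneg | hpos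
  · have h1 : ⟪(γ s).2.1, (γ s).2.2⟫ < 0 := by
      by_contra! hge
      obtain ⟨u, hu, hu0⟩ := isPreconnected_Icc.intermediate_value h0 hs hc ⟨hneg.le, hge⟩
      exact hzero u hu hu0
    rw [Real.sign_of_neg hneg, abs_of_neg h1]
    field_simp
  · have h1 : 0 < ⟪(γ s).2.1, (γ s).2.2⟫ := by
      by_contra! hle
      obtain ⟨u, hu, hu0⟩ := isPreconnected_Icc.intermediate_value hs h0 hc ⟨hle, hpos.le⟩
      exact hzero u hu hu0
    rw [Real.sign_of_pos hpos, abs_of_pos h1]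
    field_simp

lemma pos_integralCurve (hκ : 0 < κ) {s : ℝ} (hs : s ∈ Icc (0 : ℝ) 1) :
    (γ s).2.1 = orbitPos κ ‖(γ 0).2.1‖ (starRV κ (γ 0).2.1 (γ 0).2.2 (s • ε))
      (starL κ (γ 0).2.1 (γ 0).2.2 (s • ε)) (starLRL κ (γ 0).2.1 (γ 0).2.2 (s • ε)) := by
  rw [← inner_integralCurve hγ hs, ← (elements_integralCurve hγ hs).1,
    ← (elements_integralCurve hγ hs).2, ← norm_pos_integralCurve hγ hs]
  exact (orbitPos_elements κ (pos_ne_zero_of_mem_gaugeDomain (hγ s hs).1)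
    (lrl_ne_zero hκ (hγ s hs).1)).symm

lemma vel_integralCurve (hκ : 0 < κ) {s : ℝ} (hs : s ∈ Icc (0 : ℝ) 1) :
    (γ s).2.2 = orbitVel κ (energy κ (γ 0).2.1 (γ 0).2.2) ‖(γ 0).2.1‖
      (starRV κ (γ 0).2.1 (γ 0).2.2 (s • ε))
      (starL κ (γ 0).2.1 (γ 0).2.2 (s • ε)) (starLRL κ (γ 0).2.1 (γ 0).2.2 (s • ε)) := by
  rw [← inner_integralCurve hγ hs, ← (elements_integralCurve hγ hs).1,
    ← (elements_integralCurve hγ hs).2, ← norm_pos_integralCurve hγ hs,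
    ← energy_integralCurve hγ hs]
  exact (orbitVel_elements κ (pos_ne_zero_of_mem_gaugeDomain (hγ s hs).1)
    (lrl_ne_zero hκ (hγ s hs).1)).symm

lemma gauge_integralCurve (hκ : 0 < κ) {s : ℝ} (hs : s ∈ Icc (0 : ℝ) 1) :
    gauge (γ s) = starTau κ (γ 0).2.1 (γ 0).2.2 (s • ε) := by
  have h0 : (0 : ℝ) ∈ Icc (0 : ℝ) 1 := left_mem_Icc.mpr zero_le_one
  rw [starTau_eq (pos_ne_zero_of_mem_gaugeDomain (hγ 0 h0).1), ← pos_integralCurve hγ hκ hs,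
    ← inner_integralCurve hγ hs, ← (elements_integralCurve hγ hs).1, gauge]

/-- The time component of an integral curve is obtained by a quadrature. -/
lemma time_integralCurve (hκ : 0 < κ) :
    IntervalIntegrable (fun s : ℝ => ⟪starTau κ (γ 0).2.1 (γ 0).2.2 (s • ε), ε⟫) volume 0 1 ∧
      (γ 1).1 = (γ 0).1
        + ∫ s in (0 : ℝ)..1, ⟪starTau κ (γ 0).2.1 (γ 0).2.2 (s • ε), ε⟫ := by
  have hc : ContinuousOn (fun s : ℝ => ⟪starTau κ (γ 0).2.1 (γ 0).2.2 (s • ε), ε⟫)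
      (Icc 0 1) := by
    have := ContinuousOn.inner (𝕜 := ℝ) (continuousOn_gauge (continuousOn_pos_integralCurve hγ)
      (continuousOn_vel_integralCurve hγ) (fun s hs => (hγ s hs).1)
      (fun s => (γ s).1)) (continuousOn_const (c := ε))
    refine this.congr (fun s hs => ?_)
    simp only
    rw [← gauge_integralCurve hγ hκ hs]
  have hi : IntervalIntegrable
      (fun s : ℝ => ⟪starTau κ (γ 0).2.1 (γ 0).2.2 (s • ε), ε⟫) volume 0 1 :=
    hc.intervalIntegrable_of_Icc zero_le_one
  refine ⟨hi, ?_⟩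
  rw [intervalIntegral.integral_eq_sub_of_hasDeriv_right_of_le (f := fun s => (γ s).1)
    zero_le_one (fun s hs => (hasDerivWithinAt_time (hγ s hs).2).continuousWithinAt) ?_ hi]
  · ring
  · intro s hs
    have hs' := Ioo_subset_Icc_self hs
    rw [← gauge_integralCurve hγ hκ hs']
    exact ((hasDerivWithinAt_time (hγ s hs').2).hasDerivAt
      (Icc_mem_nhds hs.1 hs.2)).hasDerivWithinAt

end IntegralCurve

/-! ### Existence of the transformation -/

section Existence

variable {κ : ℝ} {r v ε : E3}

lemma differentiableWithinAt_starRV (κ : ℝ) (r v ε : E3) {s : ℝ} (hs : s ∈ Icc (0 : ℝ) 1)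
    (h : 0 < starRadicand κ r v (s • ε)) :
    DifferentiableWithinAt ℝ (fun u : ℝ => starRV κ r v (u • ε)) (Icc 0 1) s := by
  have hd : DifferentiableWithinAt ℝ (fun u : ℝ => starRadicand κ r v (u • ε)) (Icc 0 1) s := by
    simp only [starRadicand, div_pow]
    exact ((((hasDerivWithinAt_starL κ r v ε hs).norm_sq).div_const _).const_sub
      _).differentiableWithinAt
  exact (hd.sqrt h.ne').const_mul _

/-- A point with the transformed orbital elements moves along the generator: its velocity and
the generator change the orbital elements, `|r|` and `|v|` alike, which determines them. The gauge
function does not depend on the time, which is set to `0` in its argument. -/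
lemma hasDerivWithinAt_orbit_star (hκ : 0 < κ) (hrv : ⟪r, v⟫ ≠ 0)
    (h : ∀ s ∈ Icc (0 : ℝ) 1, 0 < starRadicand κ r v (s • ε)) {x y : ℝ → E3}
    (hxdef : x = fun s => orbitPos κ ‖r‖ (starRV κ r v (s • ε)) (starL κ r v (s • ε))
      (starLRL κ r v (s • ε)))
    (hydef : y = fun s => orbitVel κ (energy κ r v) ‖r‖ (starRV κ r v (s • ε))
      (starL κ r v (s • ε)) (starLRL κ r v (s • ε)))
    {s : ℝ} (hs : s ∈ Icc (0 : ℝ) 1) :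
    ⟪x s, y s⟫ ≠ 0 ∧
    HasDerivWithinAt x (⟪gauge (0, x s, y s), ε⟫ • y s + lrlP ε (x s) (y s)) (Icc 0 1) s ∧
    HasDerivWithinAt y (⟪gauge (0, x s, y s), ε⟫ • (-(κ / ‖x s‖ ^ 3) • x s)
      + lrlDtP κ ε (x s) (y s)) (Icc 0 1) s := by
  have hr : r ≠ 0 := by rintro rfl; simp at hrv
  have hR : 0 < ‖r‖ := norm_pos_iff.mpr hr
  have hA : ∀ u ∈ Icc (0 : ℝ) 1, starLRL κ r v (u • ε) ≠ 0 :=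
    fun u hu => starLRL_ne_zero hκ hr (h u hu)
  have hLA : ∀ u : ℝ, ⟪starL κ r v (u • ε), starLRL κ r v (u • ε)⟫ = 0 :=
    fun u => inner_starL_starLRL κ r v _
  have hN := fun u : ℝ => norm_starLRL_sq (κ := κ) (v := v) hr (u • ε)
  have hg : ∀ u ∈ Icc (0 : ℝ) 1, _ := fun u hu => starRV_sq (κ := κ) hrv (h u hu).le
  have hnx : ∀ u ∈ Icc (0 : ℝ) 1, ‖x u‖ = ‖r‖ := fun u hu => by
    rw [hxdef]; exact norm_orbitPos (hLA u) (hA u hu) (hN u) hR (hg u hu)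
  have hny : ∀ u ∈ Icc (0 : ℝ) 1, ‖y u‖ ^ 2 = 2 * (energy κ r v + κ / ‖r‖) := fun u hu => by
    rw [hydef]; exact norm_orbitVel_sq (hLA u) (hA u hu) (hN u) hR (hg u hu)
  have hxy : ∀ u ∈ Icc (0 : ℝ) 1, ⟪x u, y u⟫ = starRV κ r v (u • ε) := fun u hu => by
    rw [hxdef, hydef]; exact inner_orbitPos_orbitVel (hLA u) (hA u hu) (hN u) hR
  have hE : ∀ u ∈ Icc (0 : ℝ) 1, energy κ (x u) (y u) = energy κ r v := fun u hu => by
    rw [hxdef, hydef]; exact energy_orbit (hLA u) (hA u hu) (hN u) hR (hg u hu)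
  have hLxy : ∀ u ∈ Icc (0 : ℝ) 1, angMom (x u) (y u) = starL κ r v (u • ε) := fun u hu => by
    rw [hxdef, hydef]; exact angMom_orbit (hLA u) (hA u hu) (hN u) hR (hg u hu)
  have hAxy : ∀ u ∈ Icc (0 : ℝ) 1, lrl κ (x u) (y u) = starLRL κ r v (u • ε) := fun u hu => by
    rw [hxdef, hydef]; exact lrl_orbit (hLA u) (hA u hu) (hN u) hR (hg u hu)
  have hne : ⟪x s, y s⟫ ≠ 0 := by
    rw [hxy s hs, starRV]
    have h1 : Real.sign ⟪r, v⟫ ≠ 0 := by rwa [Ne, Real.sign_eq_zero_iff]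
    have h2 := Real.sqrt_pos.mpr (h s hs)
    positivity
  have hxs : x s ≠ 0 := by
    rw [← norm_pos_iff, hnx s hs]; exact hR
  have hud : UniqueDiffWithinAt ℝ (Icc (0 : ℝ) 1) s := uniqueDiffOn_Icc zero_lt_one s hs
  -- the curve is differentiable
  have hL' := hasDerivWithinAt_starL κ r v ε hs
  have hA' := hasDerivWithinAt_starLRL κ r v ε hs
  have hg' := differentiableWithinAt_starRV κ r v ε hs (h s hs)
  have hinv : DifferentiableWithinAt ℝ (fun u : ℝ => (‖starLRL κ r v (u • ε)‖ ^ 2)⁻¹)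
      (Icc 0 1) s := hA'.norm_sq.differentiableWithinAt.inv
        (pow_ne_zero 2 (norm_ne_zero_iff.mpr (hA s hs)))
  have hC := (hasDerivWithinAt_cross hL' hA').differentiableWithinAt
  have hC' : DifferentiableWithinAt ℝ (fun u : ℝ => (2 * energy κ r v + κ / ‖r‖) •
      cross (starL κ r v (u • ε)) (starLRL κ r v (u • ε))) (Icc 0 1) s :=
    hC.const_smul (2 * energy κ r v + κ / ‖r‖)
  obtain ⟨x', hx'⟩ : ∃ x', HasDerivWithinAt x x' (Icc 0 1) s := by
    refine ⟨_, DifferentiableWithinAt.hasDerivWithinAt ?_⟩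
    rw [hxdef]
    exact hinv.smul (((hL'.norm_sq.differentiableWithinAt.sub_const _).smul
      hA'.differentiableWithinAt).add (hg'.smul hC))
  obtain ⟨y', hy'⟩ : ∃ y', HasDerivWithinAt y y' (Icc 0 1) s := by
    refine ⟨_, DifferentiableWithinAt.hasDerivWithinAt ?_⟩
    rw [hydef]
    exact hinv.smul (((((hg'.const_mul κ).div_const _).neg).smul
      hA'.differentiableWithinAt).add hC')
  -- its velocity and the generator have the same effect on the orbital elements
  have e1 : cross x' (y s) + cross (x s) y' = cross ε (lrl κ (x s) (y s)) := by
    rw [hAxy s hs]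
    exact hud.eq_deriv _ (hasDerivWithinAt_cross hx' hy') (hL'.congr hLxy (hLxy s hs))
  have e2 : (‖y s‖ ^ 2 - κ / ‖x s‖) • x' - (⟪x s, y'⟫ + ⟪x', y s⟫) • y s - ⟪x s, y s⟫ • y'
      = (-(2 * energy κ (x s) (y s))) • cross ε (angMom (x s) (y s)) := by
    rw [hE s hs, hLxy s hs]
    refine hud.eq_deriv _ (hasDerivWithinAt_lrl hs hx' hy'
      (fun u hu => (hnx u hu).trans (hnx s hs).symm) (fun u hu => ?_))
      (hA'.congr hAxy (hAxy s hs))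
    rw [← sq_eq_sq₀ (norm_nonneg _) (norm_nonneg _), hny u hu, hny s hs]
  have e3 : ⟪x s, x'⟫ = 0 := by
    have := hud.eq_deriv _ hx'.norm_sq ((hasDerivWithinAt_const s (Icc (0 : ℝ) 1)
      (‖r‖ ^ 2)).congr (fun u hu => by rw [hnx u hu]) (by rw [hnx s hs]))
    linarith
  have e4 : ⟪y s, y'⟫ = 0 := by
    have := hud.eq_deriv _ hy'.norm_sq ((hasDerivWithinAt_const s (Icc (0 : ℝ) 1)
      (2 * (energy κ r v + κ / ‖r‖))).congr hny (hny s hs))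
    linarith
  set w := ⟪gauge (0, x s, y s), ε⟫
  have f1 := cross_generator κ w ε (x s) (y s)
  have f3 : ⟪x s, w • y s + lrlP ε (x s) (y s)⟫ = 0 := inner_pos_generator 0 ε hne
  have f4 := inner_vel_generator κ w ε (x s) (y s) hxs f3
  have f2 := lrl_generator κ w ε (x s) (y s) hxs f3 f4
  set X := w • y s + lrlP ε (x s) (y s)
  set Y := w • (-(κ / ‖x s‖ ^ 3) • x s) + lrlDtP κ ε (x s) (y s)
  have key := eq_zero_of_elements_stationary (x := x' - X) (y := y' - Y) hκ hne
    (by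
      rw [cross_sub_left, cross_sub_right, ← sub_eq_zero.mpr (e1.trans f1.symm)]
      module)
    (by
      rw [inner_sub_left, inner_sub_right, ← sub_eq_zero.mpr (e2.trans f2.symm)]
      module)
    (by rw [inner_sub_right, e3, f3, sub_zero])
    (by rw [inner_sub_right, e4, f4, sub_zero])
  rw [sub_eq_zero, sub_eq_zero] at key
  exact ⟨hne, key.1 ▸ hx', key.2 ▸ hy'⟩

/-- The transformation exists as long as the squared radial velocity stays positive: the
transformed orbital elements give position and velocity, a quadrature gives the time. -/
lemma exists_isLRLTransform (hκ : 0 < κ) (hrv : ⟪r, v⟫ ≠ 0) (t : ℝ)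
    (h : ∀ s ∈ Icc (0 : ℝ) 1, 0 < starRadicand κ r v (s • ε)) :
    ∃ y, IsLRLTransform κ ε (t, r, v) y := by
  have hr : r ≠ 0 := by rintro rfl; simp at hrv
  have hR : 0 < ‖r‖ := norm_pos_iff.mpr hr
  obtain ⟨x, hx⟩ : ∃ x : ℝ → E3, x = fun s => orbitPos κ ‖r‖ (starRV κ r v (s • ε))
    (starL κ r v (s • ε)) (starLRL κ r v (s • ε)) := ⟨_, rfl⟩
  obtain ⟨y, hy⟩ : ∃ y : ℝ → E3, y = fun s => orbitVel κ (energy κ r v) ‖r‖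
    (starRV κ r v (s • ε)) (starL κ r v (s • ε)) (starLRL κ r v (s • ε)) := ⟨_, rfl⟩
  have hd := fun s (hs : s ∈ Icc (0 : ℝ) 1) =>
    hasDerivWithinAt_orbit_star hκ hrv h hx hy hs
  have hw : ContinuousOn (fun s => ⟪gauge (0, x s, y s), ε⟫) (Icc 0 1) :=
    ContinuousOn.inner (𝕜 := ℝ) (continuousOn_gauge
      (fun s hs => (hd s hs).2.1.continuousWithinAt)
      (fun s hs => (hd s hs).2.2.continuousWithinAt) (fun s hs => (hd s hs).1) (fun _ => 0))
      continuousOn_const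
  -- the gauge coefficient, continued by constants, has a primitive
  have hW : Continuous (IccExtend (zero_le_one (α := ℝ))
      ((Icc (0 : ℝ) 1).domRestrict (fun s => ⟪gauge (0, x s, y s), ε⟫))) :=
    (continuousOn_iff_continuous_domRestrict.mp hw).Icc_extend'
  set W := IccExtend (zero_le_one (α := ℝ))
    ((Icc (0 : ℝ) 1).domRestrict (fun s => ⟪gauge (0, x s, y s), ε⟫)) with hWdef
  have hg0 : starRV κ r v 0 = ⟪r, v⟫ := by
    have h1 : starRadicand κ r v 0 = (⟪r, v⟫ / ‖r‖) ^ 2 := by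
      rw [starRadicand, starL_zero, ← energy_mul_two, div_pow, norm_angMom_sq]
      field_simp
      ring
    rw [starRV, h1, Real.sqrt_sq_eq_abs, abs_div, abs_norm]
    have h2 : Real.sign ⟪r, v⟫ * |⟪r, v⟫| = ⟪r, v⟫ := by
      rcases lt_or_gt_of_ne hrv with h | h
      · rw [Real.sign_of_neg h, abs_of_neg h]; ring
      · rw [Real.sign_of_pos h, abs_of_pos h]; ring
    field_simp
    exact h2
  refine ⟨_, fun s => (t + ∫ u in (0 : ℝ)..s, W u, x s, y s), ?_, rfl, fun s hs => ?_⟩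
  · simp only [intervalIntegral.integral_same, add_zero, hx, hy, zero_smul, hg0, starL_zero,
      starLRL_zero, orbitPos_elements κ hr (lrl_ne_zero hκ hrv),
      orbitVel_elements κ hr (lrl_ne_zero hκ hrv)]
  · obtain ⟨hne, hx', hy'⟩ := hd s hs
    refine ⟨hne, ?_⟩
    have ht : HasDerivWithinAt (fun u => t + ∫ z in (0 : ℝ)..u, W z)
        ⟪gauge (0, x s, y s), ε⟫ (Icc 0 1) s := by
      have := ((hW.integral_hasStrictDerivAt 0 s).hasDerivAt.const_add t).hasDerivWithinAt
        (s := Icc 0 1)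
      refine this.congr_deriv ?_
      rw [hWdef, IccExtend_of_mem _ _ hs]
      rfl
    refine (ht.prodMk (hx'.prodMk hy')).congr_deriv ?_
    simp [lrlY, totalD, gauge]

end Existence

end Kepler

/-! ### The explicit form of the transformation -/

theorem mainTheorem3 (κ : ℝ) (hκ : 0 < κ) (t : ℝ) (r v ε : Kepler.E3) (hrv : ⟪r, v⟫ ≠ 0) :
    -- the transformation `exp(ε · Y)` is defined at `(t, r, v)` exactly as long as the radial
    -- velocity does not vanish on the way
    ((∃ y, Kepler.IsLRLTransform κ ε (t, r, v) y) ↔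
      ∀ s ∈ Icc (0 : ℝ) 1, 0 < Kepler.starRadicand κ r v (s • ε)) ∧
    ∀ (t' : ℝ) (r' v' : Kepler.E3), Kepler.IsLRLTransform κ ε (t, r, v) (t', r', v') →
      -- explicit form
      (IntervalIntegrable (fun s : ℝ => ⟪Kepler.starTau κ r v (s • ε), ε⟫) volume 0 1 ∧
        t' = t + ∫ s in (0 : ℝ)..1, ⟪Kepler.starTau κ r v (s • ε), ε⟫) ∧
      r' = Kepler.alphaR κ r v ε • Kepler.starTheta κ r v ε
        + Kepler.betaR κ r v ε • Kepler.cross (Kepler.starL κ r v ε) (Kepler.starTheta κ r v ε) ∧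
      v' = Kepler.alphaV κ r v ε • Kepler.starTheta κ r v ε
        + Kepler.betaV κ r v ε • Kepler.cross (Kepler.starL κ r v ε) (Kepler.starTheta κ r v ε) ∧
      Kepler.angMom r' v' = Kepler.starL κ r v ε ∧
      Kepler.lrlDir κ r' v' = Kepler.starTheta κ r v ε ∧
      ‖Kepler.lrl κ r' v'‖ = Kepler.starA κ r v ε ∧
      -- invariants
      Kepler.energy κ r' v' = Kepler.energy κ r v ∧
      ‖r'‖ = ‖r‖ ∧
      -- non-zero energy
      (Kepler.energy κ r v ≠ 0 →
        Kepler.lrlM κ r v = ‖Kepler.lrlM κ r v‖ • Kepler.lrlDir κ r v ∧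
        ‖Kepler.lrlM κ r v‖ ^ 2 = Real.sign (Kepler.energy κ r v) * ‖Kepler.angMom r v‖ ^ 2
          + κ ^ 2 / (2 * |Kepler.energy κ r v|) ∧
        (Kepler.angMom r' v', Kepler.lrlM κ r' v') =
          Kepler.twistedRotation (Kepler.energy κ r v)
            (√(2 * |Kepler.energy κ r v|) * ‖ε‖) (‖ε‖⁻¹ • ε)
            (Kepler.angMom r v, Kepler.lrlM κ r v) ∧
        ‖Kepler.lrlM κ r' v'‖ ^ 2
            - Real.sign (Kepler.energy κ r v) * ‖Kepler.angMom r' v'‖ ^ 2 =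
          ‖Kepler.lrlM κ r v‖ ^ 2
            - Real.sign (Kepler.energy κ r v) * ‖Kepler.angMom r v‖ ^ 2) ∧
      -- zero energy
      (Kepler.energy κ r v = 0 →
        Kepler.lrlDir κ r' v' = Kepler.lrlDir κ r v ∧
        Kepler.angMom r' v' = Kepler.angMom r v
          + ‖Kepler.lrl κ r v‖ • Kepler.cross ε (Kepler.lrlDir κ r v) ∧
        ‖Kepler.lrl κ r v‖ ^ 2
          = κ ^ 2 + 2 * Kepler.energy κ r v * ‖Kepler.angMom r v‖ ^ 2 ∧
        ‖Kepler.lrl κ r' v'‖ = ‖Kepler.lrl κ r v‖ *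
          √(1 + 2 * Kepler.energy κ r v * ‖Kepler.lrl κ r v‖⁻¹ *
            (⟪ε, Kepler.cross (Kepler.lrlDir κ r v) (Kepler.angMom r v)⟫
              + ‖ε‖ ^ 2 - ⟪ε, Kepler.lrlDir κ r v⟫ ^ 2))) := by
  have hr : r ≠ 0 := by rintro rfl; simp at hrv
  refine ⟨⟨?_, Kepler.exists_isLRLTransform hκ hrv t⟩, ?_⟩
  · rintro ⟨y, γ, h0, -, hγ⟩ s hs
    have := Kepler.starRadicand_pos_integralCurve hγ hs
    rwa [h0] at this
  rintro t' r' v' ⟨γ, h0, h1, hγ⟩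
  have hm : (1 : ℝ) ∈ Icc (0 : ℝ) 1 := right_mem_Icc.mpr zero_le_one
  have hL := (Kepler.elements_integralCurve hγ hm).1
  have hA := (Kepler.elements_integralCurve hγ hm).2
  have hE := Kepler.energy_integralCurve hγ hm
  have hn := Kepler.norm_pos_integralCurve hγ hm
  have hpos := Kepler.pos_integralCurve hγ hκ hm
  have hvel := Kepler.vel_integralCurve hγ hκ hm
  have ht := Kepler.time_integralCurve hγ hκ
  simp only [h0, h1, one_smul] at hL hA hE hn hpos hvel ht
  rw [Kepler.orbitPos_star hr] at hpos
  rw [Kepler.orbitVel_star hr] at hvel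
  have hTheta : Kepler.lrlDir κ r' v' = Kepler.starTheta κ r v ε := by
    rw [Kepler.lrlDir, hA, Kepler.starTheta_eq]
  have hnA := Kepler.norm_lrl_sq κ v hr
  have hnA' := Kepler.norm_starLRL_sq (κ := κ) (v := v) hr ε
  refine ⟨ht, hpos, hvel, hL, hTheta, by rw [hA, Kepler.starA_eq hr], hE, hn, ?_, ?_⟩
  · intro hE0
    have hc := Kepler.sqrt_two_mul_abs_pos hE0
    have hc2 : √(2 * |Kepler.energy κ r v|) ^ 2 = 2 * |Kepler.energy κ r v| :=
      Real.sq_sqrt (by positivity)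
    have habs : 0 < |Kepler.energy κ r v| := abs_pos.mpr hE0
    have hsign : Kepler.energy κ r v = Real.sign (Kepler.energy κ r v) * |Kepler.energy κ r v| := by
      rcases lt_or_gt_of_ne hE0 with h | h
      · rw [Real.sign_of_neg h, abs_of_neg h]; ring
      · rw [Real.sign_of_pos h, abs_of_pos h]; ring
    have hM : ∀ (a b : Kepler.E3), Kepler.energy κ a b = Kepler.energy κ r v →
        ‖Kepler.lrl κ a b‖ ^ 2
          = κ ^ 2 + 2 * Kepler.energy κ r v * ‖Kepler.angMom a b‖ ^ 2 →
        ‖Kepler.lrlM κ a b‖ ^ 2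
          = Real.sign (Kepler.energy κ r v) * ‖Kepler.angMom a b‖ ^ 2
            + κ ^ 2 / (2 * |Kepler.energy κ r v|) := by
      intro a b hab hnab
      rw [Kepler.lrlM, hab, norm_smul, mul_pow, norm_inv, inv_pow, Real.norm_of_nonneg hc.le,
        hc2, hnab]
      field_simp
      linear_combination 2 * ‖Kepler.angMom a b‖ ^ 2 * hsign
    refine ⟨?_, hM r v rfl hnA, ?_, ?_⟩
    · rw [Kepler.lrlM, norm_smul, norm_inv, Real.norm_of_nonneg hc.le, mul_smul,
        Kepler.norm_smul_lrlDir]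
    · rw [hL, Kepler.lrlM, hE, hA, Kepler.starL, Kepler.starLRL, if_neg hE0, if_neg hE0,
        smul_smul, inv_mul_cancel₀ hc.ne', one_smul]
      rfl
    · rw [hM r v rfl hnA, hM r' v' hE (by rw [hA, hL, hnA'])]
      ring
  · intro hE0
    refine ⟨?_, ?_, hnA, ?_⟩
    · rw [hTheta, Kepler.starTheta, if_pos hE0]
    · rw [hL, Kepler.starL, if_pos hE0]
    · rw [hA, Kepler.starLRL, if_pos hE0, hE0]
      simp
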